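/- Notation. $\mathbf S^n$ is the space of real symmetric $n\times n$ matrices, $\mathbf S^n_+$ its positive semidefinite cone, $A\succeq B$ means $A-B\in\mathbf S^n_+$, $\|\cdot\|$ is the spectral norm and $\|\cdot\|_F$ the Frobenius norm; $[u;1]$ is the column vector $u$ with an entry $1$ appended. Setup. Let $U\subset\mathbf R^m$ be nonempty and bounded, $V\subset\mathbf R^k$ nonempty, convex and compact, $v\mapsto M(v)$ an affine map $\mathbf R^k\to\mathbf S^d$ with $M(v)\succeq 0$ for $v\in V$, $A\in\mathbf R^{d\times(m+1)}$, $Q\in\mathbf S^{m+1}$, $q\in\mathbf R^k$, $\epsilon\in(0,1)$, and $K\ge 1$ an integer. The functional of interest is $F(u,v)=[u;1]^TQ[u;1]+q^Tv$. For $(u,v)\in U\times V$ one observes $\zeta^K=(\zeta_1,\dots,\zeta_K)$ with $\zeta_i$ i.i.d. $\sim\mathcal N(A[u;1],M(v))$. The $\epsilon$-risk of a Borel estimate $\widehat g:(\mathbf R^d)^K\to\mathbf R$ is the smallest $\rho$ such that $\mathrm{Prob}_{\zeta^K\sim[\mathcal N(A[u;1],M(v))]^K}\{|\widehat g(\zeta^K)-F(u,v)|>\rho\}\le\epsilon$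 for all $(u,v)\in U\times V$. Let $\mathcal Z\subset\{Z\in\mathbf S^{m+1}_+:Z_{m+1,m+1}=1\}$ be convex and compact with $[u;1][u;1]^T\in\mathcal Z$ for all $u\in U$. Let $\Theta_*\in\mathbf S^d$, $\Theta_*\succ0$, and $\delta\in[0,2]$ be such that $M(v)\preceq\Theta_*$ and $\|M(v)^{1/2}\Theta_*^{-1/2}-I\|\le\delta$ for all $v\in V$. Let $\gamma\in(0,1)$, let $B=[A;e_{m+1}^T]$ (the matrix $A$ with the row $e_{m+1}^T=[0,\dots,0,1]$ added below), and let $G(v,Z)=\mathrm{Tr}(QZ)+q^Tv$. For $h\in\mathbf R^d$, $H,\Theta\in\mathbf S^d$ with $-\gamma\Theta_*^{-1}\preceq H\preceq\gamma\Theta_*^{-1}$, and $Z\in\mathbf S^{d+1}$, put $$\begin{aligned}\Phi(h,H;\Theta,Z)={}&-\tfrac12\ln\mathrm{Det}\big(I-\Theta_*^{1/2}H\Theta_*^{1/2}\big)+\tfrac12\mathrm{Tr}\big([\Theta-\Theta_*]H\big)+\frac{\delta(2+\delta)}{2\big(1-\|\Theta_*^{1/2}H\Theta_*^{1/2}\|\big)}\big\|\Theta_*^{1/2}H\Theta_*^{1/2}\big\|_F^2\\&+\tfrac12\mathrm{Tr}\Big(Z\Big[\begin{bmatrix}H&h\\h^T&0\end{bmatrix}+[H,h]^T[\Theta_*^{-1}-H]^{-1}[H,h]\Big]\Big).\end{aligned}$$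 For $(h,H)\in\mathbf R^d\times\mathbf S^d$ set $$\widehat\Psi_\pm(h,H)=\max_{(v,Z)\in V\times\mathcal Z}\ \inf_{\substack{\alpha>0,\\-\gamma\alpha\Theta_*^{-1}\preceq H\preceq\gamma\alpha\Theta_*^{-1}}}\Big\{\alpha\Phi\big(\pm\tfrac h\alpha,\pm\tfrac H\alpha;M(v),BZB^T\big)\mp G(v,Z)+\tfrac\alpha K\ln\tfrac2\epsilon\Big\}.$$ Proposition 5.1. (a) $\widehat\Psi_\pm$ are well-defined real-valued convex functions on $\mathbf R^d\times\mathbf S^d$: the infima are finite and the maxima are attained. (b) If $(h,H)\in\mathbf R^d\times\mathbf S^d$ and $\rho,\varkappa\in\mathbf R$ satisfy $$\widehat\Psi_+(h,H)\le\rho-\varkappa,\qquad\widehat\Psi_-(h,H)\le\rho+\varkappa,$$ then the estimate $$\widehat g(\zeta^K)=\frac1K\sum_{i=1}^K\Big[h^T\zeta_i+\tfrac12\zeta_i^TH\zeta_i\Big]+\varkappa$$ of $F(u,v)$ has $\epsilon$-risk at most $\rho$; in particular $$\mathrm{Prob}_{\zeta^K\sim[\mathcal N(A[u;1],M(v))]^K}\big\{|F(u,v)-\widehat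 g(\zeta^K)|>\rho\big\}\le\epsilon\qquad\text{for all }(u,v)\in U\times V.$$ (c) In particular, for every $(h,H)\in\mathbf R^d\times\mathbf S^d$, the estimate $\widehat g$ with $\varkappa=\tfrac12[\widehat\Psi_-(h,H)-\widehat\Psi_+(h,H)]$ has $\epsilon$-risk at most $\tfrac12[\widehat\Psi_+(h,H)+\widehat\Psi_-(h,H)]$. -/

import Mathlib

open scoped MatrixOrder

noncomputable section

namespace QuadLift

/-- The vector `[u; 1]`.  Coordinates of `ℝ^{n+1}` are indexed by `Fin n ⊕ Unit`,
`Sum.inr ()` being the last one. -/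
def lift1 {n : ℕ} (u : Fin n → ℝ) : Fin n ⊕ Unit → ℝ :=
  Sum.elim u (fun _ => 1)

/-- `[u; 1][u; 1]ᵀ`. -/
def liftMat {n : ℕ} (u : Fin n → ℝ) : Matrix (Fin n ⊕ Unit) (Fin n ⊕ Unit) ℝ :=
  Matrix.vecMulVec (lift1 u) (lift1 u)

open scoped Matrix.Norms.L2Operator in
/-- The spectral norm `‖·‖` of a square matrix (operator norm for Euclidean norms). -/
def specNorm {d : ℕ} (X : Matrix (Fin d) (Fin d) ℝ) : ℝ := ‖X‖

/-- The square of the Frobenius norm. -/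
def frobSq {d : ℕ} (X : Matrix (Fin d) (Fin d) ℝ) : ℝ := ∑ i, ∑ j, X i j ^ 2

/-- The `d × (d+1)` matrix `[H, h]`. -/
def rowBlock {d : ℕ} (h : Fin d → ℝ) (H : Matrix (Fin d) (Fin d) ℝ) :
    Matrix (Fin d) (Fin d ⊕ Unit) ℝ :=
  Matrix.fromCols H (Matrix.replicateCol Unit h)

/-- The function `Υ(H, Θ)`:
`-½ ln Det(I - Θ_*^{1/2} H Θ_*^{1/2}) + ½ Tr([Θ - Θ_*] H)
  + δ(2+δ) / (2 (1 - ‖Θ_*^{1/2} H Θ_*^{1/2}‖)) · ‖Θ_*^{1/2} H Θ_*^{1/2}‖_F²`. -/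
def Upsilon {d : ℕ} (Θs : Matrix (Fin d) (Fin d) ℝ) (δ : ℝ)
    (H Θ : Matrix (Fin d) (Fin d) ℝ) : ℝ :=
  -(1 / 2) * Real.log (1 - CFC.sqrt Θs * H * CFC.sqrt Θs).det
    + (1 / 2) * ((Θ - Θs) * H).trace
    + δ * (2 + δ) / (2 * (1 - specNorm (CFC.sqrt Θs * H * CFC.sqrt Θs)))
        * frobSq (CFC.sqrt Θs * H * CFC.sqrt Θs)

/-- The function `Γ(h, H; Z)`:
`½ Tr( Z ( [H, h; hᵀ, 0] + [H, h]ᵀ [Θ_*⁻¹ - H]⁻¹ [H, h] ) )`. -/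
def Gam {d : ℕ} (Θs : Matrix (Fin d) (Fin d) ℝ)
    (h : Fin d → ℝ) (H : Matrix (Fin d) (Fin d) ℝ)
    (Z : Matrix (Fin d ⊕ Unit) (Fin d ⊕ Unit) ℝ) : ℝ :=
  (1 / 2) * (Z * (Matrix.fromBlocks H (Matrix.replicateCol Unit h) (Matrix.replicateRow Unit h) 0
    + (rowBlock h H).transpose * (Θs⁻¹ - H)⁻¹ * rowBlock h H)).trace

/-- `Φ(h, H; Θ, Z) = Υ(H, Θ) + Γ(h, H; Z)`. -/
def Phi {d : ℕ} (Θs : Matrix (Fin d) (Fin d) ℝ) (δ : ℝ)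
    (h : Fin d → ℝ) (H : Matrix (Fin d) (Fin d) ℝ)
    (Θ : Matrix (Fin d) (Fin d) ℝ) (Z : Matrix (Fin d ⊕ Unit) (Fin d ⊕ Unit) ℝ) : ℝ :=
  Upsilon Θs δ H Θ + Gam Θs h H Z

/-- The data of the estimation problem (pure data; the requirements are in `Setup.Valid`). -/
structure Setup (m k d : ℕ) where
  /-- range of the signal component `u` -/
  U : Set (Fin m → ℝ)
  /-- range of the signal component `v` -/
  V : Set (Fin k → ℝ)
  /-- the affine map `v ↦ M(v)` -/
  M : (Fin k → ℝ) →ᵃ[ℝ] Matrix (Fin d) (Fin d) ℝ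
  /-- the `d × (m+1)` matrix `A` -/
  A : Matrix (Fin d) (Fin m ⊕ Unit) ℝ
  /-- the quadratic part of the functional of interest -/
  Q : Matrix (Fin m ⊕ Unit) (Fin m ⊕ Unit) ℝ
  /-- the linear part of the functional of interest -/
  q : Fin k → ℝ
  /-- the tolerance -/
  ε : ℝ
  /-- the number of observations -/
  K : ℕ
  /-- the convex compact set containing all `[u; 1][u; 1]ᵀ`, `u ∈ U` -/
  𝒵 : Set (Matrix (Fin m ⊕ Unit) (Fin m ⊕ Unit) ℝ)
  /-- the matrix `Θ_*` -/
  Θs : Matrix (Fin d) (Fin d) ℝ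
  δ : ℝ
  γ : ℝ

namespace Setup

variable {m k d : ℕ}

/-- The requirements on the data. -/
structure Valid (S : Setup m k d) : Prop where
  U_nonempty : S.U.Nonempty
  U_bounded : Bornology.IsBounded S.U
  V_nonempty : S.V.Nonempty
  V_convex : Convex ℝ S.V
  V_compact : IsCompact S.V
  M_symm : ∀ v, (S.M v).IsSymm
  M_psd : ∀ v ∈ S.V, (S.M v).PosSemidef
  Q_symm : S.Q.IsSymm
  ε_mem : S.ε ∈ Set.Ioo (0 : ℝ) 1
  K_pos : 0 < S.K
  Z_convex : Convex ℝ S.𝒵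
  Z_compact : IsCompact S.𝒵
  Z_psd : ∀ Z ∈ S.𝒵, Z.PosSemidef
  Z_corner : ∀ Z ∈ S.𝒵, Z (Sum.inr ()) (Sum.inr ()) = 1
  Z_lift : ∀ u ∈ S.U, liftMat u ∈ S.𝒵
  Θs_posDef : S.Θs.PosDef
  δ_mem : S.δ ∈ Set.Icc (0 : ℝ) 2
  M_le : ∀ v ∈ S.V, (S.Θs - S.M v).PosSemidef
  M_close : ∀ v ∈ S.V, specNorm (CFC.sqrt (S.M v) * (CFC.sqrt S.Θs)⁻¹ - 1) ≤ S.δ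
  γ_mem : S.γ ∈ Set.Ioo (0 : ℝ) 1

/-- The functional of interest `F(u, v) = [u; 1]ᵀ Q [u; 1] + qᵀ v`. -/
def F (S : Setup m k d) (u : Fin m → ℝ) (v : Fin k → ℝ) : ℝ :=
  lift1 u ⬝ᵥ S.Q.mulVec (lift1 u) + S.q ⬝ᵥ v

/-- The linear functional `G(v, Z) = Tr(Q Z) + qᵀ v`. -/
def G (S : Setup m k d) (v : Fin k → ℝ) (Z : Matrix (Fin m ⊕ Unit) (Fin m ⊕ Unit) ℝ) : ℝ :=
  (S.Q * Z).trace + S.q ⬝ᵥ v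

/-- The `(d+1) × (m+1)` matrix `B = [A; e_{m+1}ᵀ]`. -/
def B (S : Setup m k d) : Matrix (Fin d ⊕ Unit) (Fin m ⊕ Unit) ℝ :=
  Matrix.fromRows S.A (Matrix.replicateRow Unit (Pi.single (Sum.inr ()) 1))

/-- The set of `α > 0` such that `-γ α Θ_*⁻¹ ⪯ H ⪯ γ α Θ_*⁻¹`. -/
def scales (S : Setup m k d) (H : Matrix (Fin d) (Fin d) ℝ) : Set ℝ :=
  {α | 0 < α ∧ (H + (S.γ * α) • S.Θs⁻¹).PosSemidef ∧ ((S.γ * α) • S.Θs⁻¹ - H).PosSemidef}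

/-- The expression under the infimum in `Ψ̂₊`:
`α Φ(h/α, H/α; M(v), B Z Bᵀ) - G(v, Z) + (α/K) ln(2/ε)`. -/
def objPlus (S : Setup m k d) (h : Fin d → ℝ) (H : Matrix (Fin d) (Fin d) ℝ)
    (v : Fin k → ℝ) (Z : Matrix (Fin m ⊕ Unit) (Fin m ⊕ Unit) ℝ) (α : ℝ) : ℝ :=
  α * Phi S.Θs S.δ (α⁻¹ • h) (α⁻¹ • H) (S.M v) (S.B * Z * S.B.transpose)
    - S.G v Z + α / S.K * Real.log (2 / S.ε)

/-- The expression under the infimum in `Ψ̂₋`: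
`α Φ(-h/α, -H/α; M(v), B Z Bᵀ) + G(v, Z) + (α/K) ln(2/ε)`. -/
def objMinus (S : Setup m k d) (h : Fin d → ℝ) (H : Matrix (Fin d) (Fin d) ℝ)
    (v : Fin k → ℝ) (Z : Matrix (Fin m ⊕ Unit) (Fin m ⊕ Unit) ℝ) (α : ℝ) : ℝ :=
  α * Phi S.Θs S.δ (-(α⁻¹ • h)) (-(α⁻¹ • H)) (S.M v) (S.B * Z * S.B.transpose)
    + S.G v Z + α / S.K * Real.log (2 / S.ε)

/-- The inner infimum in `Ψ̂₊`, as a function of `x = (v, Z)`. -/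
def innerPlus (S : Setup m k d) (h : Fin d → ℝ) (H : Matrix (Fin d) (Fin d) ℝ)
    (x : (Fin k → ℝ) × Matrix (Fin m ⊕ Unit) (Fin m ⊕ Unit) ℝ) : ℝ :=
  sInf (S.objPlus h H x.1 x.2 '' S.scales H)

/-- The inner infimum in `Ψ̂₋`, as a function of `x = (v, Z)`. -/
def innerMinus (S : Setup m k d) (h : Fin d → ℝ) (H : Matrix (Fin d) (Fin d) ℝ)
    (x : (Fin k → ℝ) × Matrix (Fin m ⊕ Unit) (Fin m ⊕ Unit) ℝ) : ℝ :=
  sInf (S.objMinus h H x.1 x.2 '' S.scales H)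

/-- `Ψ̂₊(h, H)`. -/
def PsiPlus (S : Setup m k d) (h : Fin d → ℝ) (H : Matrix (Fin d) (Fin d) ℝ) : ℝ :=
  sSup (S.innerPlus h H '' (S.V ×ˢ S.𝒵))

/-- `Ψ̂₋(h, H)`. -/
def PsiMinus (S : Setup m k d) (h : Fin d → ℝ) (H : Matrix (Fin d) (Fin d) ℝ) : ℝ :=
  sSup (S.innerMinus h H '' (S.V ×ˢ S.𝒵))

/-- The distribution `N(A[u; 1], M(v))` of one observation. -/
def obsLaw (S : Setup m k d) (u : Fin m → ℝ) (v : Fin k → ℝ) :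
    MeasureTheory.Measure (EuclideanSpace ℝ (Fin d)) :=
  ProbabilityTheory.multivariateGaussian (WithLp.toLp 2 (S.A.mulVec (lift1 u))) (S.M v)

/-- The distribution of the i.i.d. sample `ζ^K = (ζ_1, …, ζ_K)`. -/
def sampleLaw (S : Setup m k d) (u : Fin m → ℝ) (v : Fin k → ℝ) :
    MeasureTheory.Measure (Fin S.K → EuclideanSpace ℝ (Fin d)) :=
  MeasureTheory.Measure.pi (fun _ => S.obsLaw u v)

/-- The set of `ρ` such that
`Prob_{ζ^K ∼ P_{u,v}^K} {|g(ζ^K) - F(u, v)| > ρ} ≤ ε` for all `(u, v) ∈ U × V`. -/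
def riskBounds (S : Setup m k d) (g : (Fin S.K → EuclideanSpace ℝ (Fin d)) → ℝ) : Set ℝ :=
  {ρ | ∀ u ∈ S.U, ∀ v ∈ S.V,
    S.sampleLaw u v {ζ | ρ < |g ζ - S.F u v|} ≤ ENNReal.ofReal S.ε}

/-- `r` is the `ε`-risk of the estimate `g` (a Borel function): `r` is the smallest of the
risk bounds. -/
def IsRisk (S : Setup m k d) (g : (Fin S.K → EuclideanSpace ℝ (Fin d)) → ℝ) (r : ℝ) : Prop :=
  Measurable g ∧ IsLeast (S.riskBounds g) r

/-- The estimate `ĝ(ζ^K) = (1/K) ∑_i [hᵀ ζ_i + ½ ζ_iᵀ H ζ_i] + ϰ`. -/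
def estimate (S : Setup m k d) (h : Fin d → ℝ) (H : Matrix (Fin d) (Fin d) ℝ) (ϰ : ℝ)
    (ζ : Fin S.K → EuclideanSpace ℝ (Fin d)) : ℝ :=
  (1 / (S.K : ℝ)) * ∑ i, (h ⬝ᵥ (ζ i).ofLp + (1 / 2) * ((ζ i).ofLp ⬝ᵥ H.mulVec (ζ i).ofLp)) + ϰ

end Setup

end QuadLift

end

noncomputable section

namespace QuadLift
open Matrix

/-! ### Log-determinants and the matrix-fractional function. -/

section LinearAlgebra
variable {n : Type*} [Fintype n]

/-! The estimate is analysed by an exponential Markov bound. For one Gaussian observation `ζ` with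
mean `μ = A[u;1]` and covariance `Θ = M(v)`, the moment `E exp(hᵀζ + ½ζᵀHζ)` is explicit, but it
depends on `Θ` through `Θ^{1/2}HΘ^{1/2}`. The function `Phi` bounds its logarithm by an expression
affine in `Θ` and linear in the lifted matrix `[μ;1][μ;1]ᵀ` (`exp_moment_le_Phi`). The quadratic
part of the bound follows from `Θ ⪯ Θ_*`. The determinant part is a tangent-line bound for the
concave function `log det`, whose error is measured in Frobenius norm using `‖Θ^{1/2}Θ_*^{-1/2} - I‖
≤ δ` (`neg_half_log_det_le_Upsilon`).

Independence multiplies the exponent by `K`. Applying the bound to `(h/α, H/α)` and then Markov's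
inequality gives probability at most `ε/2` for the upper deviation as soon as `objPlus` at some `α`
is below the prescribed level (`upper_tail_le`). No minimax exchange is needed: `(v, [u;1][u;1]ᵀ)`
is a single point of `V × 𝒵`, and `α` may depend on it. The lower deviation is the same statement
for the functional `-F` with `(-h, -H)`, and a union bound gives `ε`.

For well-posedness, `Phi` is jointly convex in `(h, H)`: it is built from `-log det`, a
quadratic-over-linear term and a matrix-fractional term. Its perspective is therefore jointly convex
in `(h, H, α)`; minimizing over `α` and taking the supremum over `(v, Z)` preserve convexity. A
bound of `Phi` from below that is linear in `(h, H)` survives the perspective scaling without `α`,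
so the infima are finite. An infimum of functions continuous in `(v, Z)` is upper semicontinuous, so
it attains its maximum on the compact set `V × 𝒵`. -/

lemma dotProduct_mulVec_symm {P : Matrix n n ℝ} (hP : P.IsHermitian) (x y : n → ℝ) :
    x ⬝ᵥ P *ᵥ y = y ⬝ᵥ P *ᵥ x := by
  rw [dotProduct_mulVec, dotProduct_comm, ← mulVec_transpose]
  congr 2

/-- Factoring `Z` through its square root reduces trace statements against a positive semidefinite
`Z` to statements about single vectors. -/
lemma trace_mul_transpose_mul_eq_sum {p : Type*} [Fintype p] [DecidableEq p] {Z : Matrix p p ℝ}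
    (hZ : Z.PosSemidef) (C : Matrix n p ℝ) (R : Matrix n n ℝ) :
    (Z * (Cᵀ * R * C)).trace =
      ∑ j, (C *ᵥ (CFC.sqrt Z).col j) ⬝ᵥ R *ᵥ (C *ᵥ (CFC.sqrt Z).col j) := by
  have hs : CFC.sqrt Z * CFC.sqrt Z = Z := CFC.sqrt_mul_sqrt_self _ hZ.nonneg
  have hsH : (CFC.sqrt Z)ᵀ = CFC.sqrt Z := by
    have : (CFC.sqrt Z)ᴴ = CFC.sqrt Z := (CFC.sqrt_nonneg Z).isSelfAdjoint
    simpa using this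
  have e : (Z * (Cᵀ * R * C)).trace = ((C * CFC.sqrt Z)ᵀ * (R * (C * CFC.sqrt Z))).trace := by
    rw [transpose_mul, hsH]
    conv_lhs => rw [← hs, mul_assoc, trace_mul_comm]
    simp only [Matrix.mul_assoc]
  rw [e]
  simp only [trace, diag_apply]
  refine Finset.sum_congr rfl fun j _ => ?_
  rw [mul_apply]
  simp only [dotProduct, transpose_apply]
  refine Finset.sum_congr rfl fun i _ => ?_
  have hc : ∀ i, (C *ᵥ (CFC.sqrt Z).col j) i = (C * CFC.sqrt Z) i j := fun i => by
    simp [mulVec, dotProduct, mul_apply]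
  rw [hc, mul_apply]
  simp [mulVec, dotProduct, mul_apply]

variable [DecidableEq n]

lemma log_det_le_trace_sub_card {R : Matrix n n ℝ} (hR : R.PosDef) :
    Real.log R.det ≤ R.trace - Fintype.card n := by
  have h1 := hR.isHermitian.det_eq_prod_eigenvalues
  have h2 := hR.isHermitian.trace_eq_sum_eigenvalues
  simp only [RCLike.ofReal_real_eq_id, id] at h1 h2
  rw [h1, h2, Real.log_prod (fun i _ => (hR.eigenvalues_pos i).ne')]
  calc ∑ i, Real.log (hR.isHermitian.eigenvalues i)
      ≤ ∑ i, (hR.isHermitian.eigenvalues i - 1) :=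
        Finset.sum_le_sum fun i _ => Real.log_le_sub_one_of_pos (hR.eigenvalues_pos i)
    _ = _ := by simp

/-- Concavity of `log det` in tangent form: congruence by `P^{-1/2}` reduces it to the tangent at
the identity, which is `log λ ≤ λ - 1` summed over eigenvalues. -/
lemma log_det_le_add_trace {P Q : Matrix n n ℝ} (hP : P.PosDef) (hQ : Q.PosDef) :
    Real.log Q.det ≤ Real.log P.det + (P⁻¹ * (Q - P)).trace := by
  have hs : CFC.sqrt P⁻¹ * CFC.sqrt P⁻¹ = P⁻¹ :=
    CFC.sqrt_mul_sqrt_self _ hP.inv.posSemidef.nonneg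
  have hsH : (CFC.sqrt P⁻¹)ᴴ = CFC.sqrt P⁻¹ := (CFC.sqrt_nonneg P⁻¹).isSelfAdjoint
  have hdet : (CFC.sqrt P⁻¹).det * (CFC.sqrt P⁻¹).det = P.det⁻¹ := by
    rw [← det_mul, hs, det_nonsing_inv, Ring.inverse_eq_inv']
  have hPd := hP.det_pos
  have hunit : IsUnit (CFC.sqrt P⁻¹) := by
    rw [isUnit_iff_isUnit_det, isUnit_iff_ne_zero]
    intro h0
    rw [h0, mul_zero] at hdet
    exact (inv_pos.2 hPd).ne hdet
  have hR : (CFC.sqrt P⁻¹ * Q * CFC.sqrt P⁻¹).PosDef := by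
    have h := hQ.conjTranspose_mul_mul_same (B := CFC.sqrt P⁻¹)
      (mulVec_injective_of_isUnit hunit)
    rwa [hsH] at h
  have key := log_det_le_trace_sub_card hR
  have e1 : (CFC.sqrt P⁻¹ * Q * CFC.sqrt P⁻¹).det = Q.det * P.det⁻¹ := by
    rw [det_mul, det_mul, ← hdet]; ring
  have e2 : (CFC.sqrt P⁻¹ * Q * CFC.sqrt P⁻¹).trace = (P⁻¹ * Q).trace := by
    rw [trace_mul_cycle, hs]
  rw [e1, e2, Real.log_mul hQ.det_pos.ne' (inv_pos.2 hPd).ne', Real.log_inv] at key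
  rw [mul_sub, nonsing_inv_mul _ (isUnit_iff_ne_zero.2 hPd.ne'), trace_sub, trace_one]
  linarith

lemma inv_quadratic_eq {P : Matrix n n ℝ} (hP : P.PosDef) (x : n → ℝ) :
    x ⬝ᵥ P⁻¹ *ᵥ x = 2 * (x ⬝ᵥ P⁻¹ *ᵥ x) - (P⁻¹ *ᵥ x) ⬝ᵥ P *ᵥ (P⁻¹ *ᵥ x) := by
  rw [mulVec_mulVec, mul_nonsing_inv _ (isUnit_iff_ne_zero.2 hP.det_pos.ne'), one_mulVec,
    dotProduct_comm (P⁻¹ *ᵥ x)]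
  ring

/-- Expanding `(y - P⁻¹x)ᵀP(y - P⁻¹x) ≥ 0`. With `inv_quadratic_eq`, this exhibits `xᵀP⁻¹x` as a
maximum over `y` of functions affine in `(x, P)`. -/
lemma le_inv_quadratic {P : Matrix n n ℝ} (hP : P.PosDef) (x y : n → ℝ) :
    2 * (x ⬝ᵥ y) - y ⬝ᵥ P *ᵥ y ≤ x ⬝ᵥ P⁻¹ *ᵥ x := by
  have h := hP.posSemidef.dotProduct_mulVec_nonneg (y - P⁻¹ *ᵥ x)
  have e : P *ᵥ (P⁻¹ *ᵥ x) = x := by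
    rw [mulVec_mulVec, mul_nonsing_inv _ (isUnit_iff_ne_zero.2 hP.det_pos.ne'), one_mulVec]
  have e2 : (P⁻¹ *ᵥ x) ⬝ᵥ P *ᵥ y = x ⬝ᵥ y := by
    rw [dotProduct_mulVec_symm hP.isHermitian, e, dotProduct_comm]
  simp only [star_trivial, mulVec_sub, sub_dotProduct, dotProduct_sub, e, e2] at h
  rw [dotProduct_comm y x, dotProduct_comm (P⁻¹ *ᵥ x) x] at h
  linarith

/-- A maximum of functions affine in `(x, P)` is convex; the maximizer `y` at the combined point is
tested at both endpoints. -/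
lemma inv_quadratic_convex {P₀ P₁ : Matrix n n ℝ} (h₀ : P₀.PosDef) (h₁ : P₁.PosDef)
    {t s : ℝ} (ht : 0 ≤ t) (hs : 0 ≤ s) (hP : (t • P₀ + s • P₁).PosDef) (x₀ x₁ : n → ℝ) :
    (t • x₀ + s • x₁) ⬝ᵥ (t • P₀ + s • P₁)⁻¹ *ᵥ (t • x₀ + s • x₁) ≤
      t * (x₀ ⬝ᵥ P₀⁻¹ *ᵥ x₀) + s * (x₁ ⬝ᵥ P₁⁻¹ *ᵥ x₁) := by
  rw [inv_quadratic_eq hP]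
  set y := (t • P₀ + s • P₁)⁻¹ *ᵥ (t • x₀ + s • x₁)
  have a₀ := mul_le_mul_of_nonneg_left (le_inv_quadratic h₀ x₀ y) ht
  have a₁ := mul_le_mul_of_nonneg_left (le_inv_quadratic h₁ x₁ y) hs
  simp only [add_dotProduct, smul_dotProduct, add_mulVec, dotProduct_add, smul_mulVec,
    dotProduct_smul, smul_eq_mul]
  linarith

lemma trace_inv_quadratic_convex {p : Type*} [Fintype p] [DecidableEq p] {Z : Matrix p p ℝ}
    (hZ : Z.PosSemidef) {P₀ P₁ : Matrix n n ℝ} (h₀ : P₀.PosDef) (h₁ : P₁.PosDef)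
    {t s : ℝ} (ht : 0 ≤ t) (hs : 0 ≤ s) (hP : (t • P₀ + s • P₁).PosDef) (C₀ C₁ : Matrix n p ℝ) :
    (Z * ((t • C₀ + s • C₁)ᵀ * (t • P₀ + s • P₁)⁻¹ * (t • C₀ + s • C₁))).trace ≤
      t * (Z * (C₀ᵀ * P₀⁻¹ * C₀)).trace + s * (Z * (C₁ᵀ * P₁⁻¹ * C₁)).trace := by
  simp only [trace_mul_transpose_mul_eq_sum hZ, Finset.mul_sum, ← Finset.sum_add_distrib]
  refine Finset.sum_le_sum fun j _ => ?_
  have := inv_quadratic_convex h₀ h₁ ht hs hP (C₀ *ᵥ (CFC.sqrt Z).col j) (C₁ *ᵥ (CFC.sqrt Z).col j)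
  simpa only [add_mulVec, smul_mulVec] using this

lemma trace_inv_quadratic_nonneg {p : Type*} [Fintype p] [DecidableEq p] {Z : Matrix p p ℝ}
    (hZ : Z.PosSemidef) {P : Matrix n n ℝ} (hP : P.PosDef) (C : Matrix n p ℝ) :
    0 ≤ (Z * (Cᵀ * P⁻¹ * C)).trace := by
  rw [trace_mul_transpose_mul_eq_sum hZ]
  exact Finset.sum_nonneg fun j _ => by
    simpa using hP.inv.posSemidef.dotProduct_mulVec_nonneg (C *ᵥ (CFC.sqrt Z).col j)

end LinearAlgebra

/-! ### Spectral and Frobenius norms. -/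

section Norms
variable {d : ℕ}

/-- The Frobenius norm. -/
def frob (X : Matrix (Fin d) (Fin d) ℝ) : ℝ := √(frobSq X)

lemma frobSq_nonneg (X : Matrix (Fin d) (Fin d) ℝ) : 0 ≤ frobSq X :=
  Finset.sum_nonneg fun _ _ => Finset.sum_nonneg fun _ _ => sq_nonneg _

lemma frob_nonneg (X : Matrix (Fin d) (Fin d) ℝ) : 0 ≤ frob X := Real.sqrt_nonneg _

lemma frob_sq (X : Matrix (Fin d) (Fin d) ℝ) : frob X ^ 2 = frobSq X :=
  Real.sq_sqrt (frobSq_nonneg X)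

open scoped Matrix.Norms.Frobenius in
lemma frob_eq_norm (X : Matrix (Fin d) (Fin d) ℝ) : frob X = ‖X‖ := by
  rw [frobenius_norm_def, frob, frobSq, Real.sqrt_eq_rpow]
  simp

open scoped Matrix.Norms.Frobenius in
lemma frob_add_le (X Y : Matrix (Fin d) (Fin d) ℝ) : frob (X + Y) ≤ frob X + frob Y := by
  simp only [frob_eq_norm]
  exact norm_add_le _ _

open scoped Matrix.Norms.Frobenius in
lemma frob_smul {c : ℝ} (hc : 0 ≤ c) (X : Matrix (Fin d) (Fin d) ℝ) :
    frob (c • X) = c * frob X := by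
  simp only [frob_eq_norm]
  rw [norm_smul, Real.norm_of_nonneg hc]

lemma frobSq_transpose (X : Matrix (Fin d) (Fin d) ℝ) : frobSq Xᵀ = frobSq X :=
  Finset.sum_comm

lemma frob_transpose (X : Matrix (Fin d) (Fin d) ℝ) : frob Xᵀ = frob X := by
  rw [frob, frobSq_transpose, frob]

open scoped Matrix.Norms.L2Operator in
lemma specNorm_nonneg (X : Matrix (Fin d) (Fin d) ℝ) : 0 ≤ specNorm X := norm_nonneg X

open scoped Matrix.Norms.L2Operator in
lemma specNorm_add_le (X Y : Matrix (Fin d) (Fin d) ℝ) :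
    specNorm (X + Y) ≤ specNorm X + specNorm Y := norm_add_le _ _

open scoped Matrix.Norms.L2Operator in
lemma specNorm_neg (X : Matrix (Fin d) (Fin d) ℝ) : specNorm (-X) = specNorm X := norm_neg X

open scoped Matrix.Norms.L2Operator in
lemma specNorm_smul {c : ℝ} (hc : 0 ≤ c) (X : Matrix (Fin d) (Fin d) ℝ) :
    specNorm (c • X) = c * specNorm X := by
  unfold specNorm
  rw [norm_smul, Real.norm_of_nonneg hc]

open scoped Matrix.Norms.L2Operator in
lemma specNorm_mul_le (X Y : Matrix (Fin d) (Fin d) ℝ) :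
    specNorm (X * Y) ≤ specNorm X * specNorm Y := l2_opNorm_mul _ _

open scoped Matrix.Norms.L2Operator in
lemma specNorm_transpose (X : Matrix (Fin d) (Fin d) ℝ) : specNorm Xᵀ = specNorm X := by
  simpa [specNorm] using l2_opNorm_conjTranspose X

open scoped Matrix.Norms.L2Operator in
lemma sum_mulVec_sq_le (X : Matrix (Fin d) (Fin d) ℝ) (v : Fin d → ℝ) :
    (X *ᵥ v) ⬝ᵥ (X *ᵥ v) ≤ specNorm X ^ 2 * (v ⬝ᵥ v) := by
  have h := l2_opNorm_mulVec X (WithLp.toLp 2 v)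
  have h2 := pow_le_pow_left₀ (norm_nonneg _) h 2
  rw [mul_pow, EuclideanSpace.real_norm_sq_eq, EuclideanSpace.real_norm_sq_eq] at h2
  simpa [specNorm, dotProduct, sq] using h2

open scoped Matrix.Norms.L2Operator in
lemma specNorm_le_of_mulVec {X : Matrix (Fin d) (Fin d) ℝ} {r : ℝ} (hr : 0 ≤ r)
    (h : ∀ v, (X *ᵥ v) ⬝ᵥ (X *ᵥ v) ≤ r ^ 2 * (v ⬝ᵥ v)) : specNorm X ≤ r := by
  unfold specNorm
  rw [cstar_norm_def]
  refine ContinuousLinearMap.opNorm_le_bound _ hr fun x => ?_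
  refine le_of_sq_le_sq ?_ (by positivity)
  rw [mul_pow, EuclideanSpace.real_norm_sq_eq, EuclideanSpace.real_norm_sq_eq]
  simpa [dotProduct, sq] using h x.ofLp

lemma frobSq_mul_le (X Y : Matrix (Fin d) (Fin d) ℝ) :
    frobSq (X * Y) ≤ specNorm X ^ 2 * frobSq Y := by
  rw [← frobSq_transpose (X * Y), ← frobSq_transpose Y]
  unfold frobSq
  rw [Finset.mul_sum]
  refine Finset.sum_le_sum fun j _ => ?_
  have := sum_mulVec_sq_le X (Y.col j)
  simpa [dotProduct, mulVec, mul_apply, sq] using this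

lemma frob_mul_le (X Y : Matrix (Fin d) (Fin d) ℝ) :
    frob (X * Y) ≤ specNorm X * frob Y := by
  refine le_of_sq_le_sq ?_ (mul_nonneg (specNorm_nonneg _) (frob_nonneg _))
  rw [mul_pow, frob_sq, frob_sq]
  exact frobSq_mul_le X Y

lemma frob_mul_le' (X Y : Matrix (Fin d) (Fin d) ℝ) :
    frob (X * Y) ≤ frob X * specNorm Y := by
  rw [← frob_transpose, transpose_mul, mul_comm, ← specNorm_transpose, ← frob_transpose X]
  exact frob_mul_le _ _

lemma trace_mul_le_frob (X Y : Matrix (Fin d) (Fin d) ℝ) :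
    (X * Y).trace ≤ frob X * frob Y := by
  rw [← frob_transpose Y]
  have h := Real.sum_mul_le_sqrt_mul_sqrt (Finset.univ : Finset (Fin d × Fin d))
    (fun p => X p.1 p.2) (fun p => Yᵀ p.1 p.2)
  rw [Fintype.sum_prod_type, Fintype.sum_prod_type, Fintype.sum_prod_type] at h
  simpa [trace, mul_apply, frob, frobSq] using h

/-- Since `2 vᵀXv ≤ |v|² + |Xv|²` and `|Xv| < |v|` for `v ≠ 0`. -/
lemma posDef_one_sub {X : Matrix (Fin d) (Fin d) ℝ} (hX : X.IsHermitian) (h : specNorm X < 1) :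
    (1 - X).PosDef := by
  refine PosDef.of_dotProduct_mulVec_pos (isHermitian_one.sub hX) fun v hv => ?_
  have hv' : 0 < v ⬝ᵥ v := by
    have := dotProduct_star_self_pos_iff.2 hv
    simpa using this
  have h1 := sum_mulVec_sq_le X v
  have h2 : 0 ≤ (v - X *ᵥ v) ⬝ᵥ (v - X *ᵥ v) := by
    simpa using dotProduct_star_self_nonneg (v - X *ᵥ v)
  have h3 : specNorm X ^ 2 * (v ⬝ᵥ v) < v ⬝ᵥ v := by
    have : specNorm X ^ 2 < 1 := by
      have := specNorm_nonneg X
      nlinarith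
    nlinarith
  have h4 : v ⬝ᵥ X *ᵥ v ≤ (1 / 2) * (v ⬝ᵥ v + (X *ᵥ v) ⬝ᵥ (X *ᵥ v)) := by
    simp only [sub_dotProduct, dotProduct_sub, dotProduct_comm (X *ᵥ v) v] at h2
    linarith
  simp only [star_trivial, sub_mulVec, one_mulVec, dotProduct_sub]
  linarith

open scoped Matrix.Norms.L2Operator in
-- The two semidefinite bounds confine every eigenvalue to `[-r, r]`, and unitary diagonalization
-- preserves the operator norm.
lemma specNorm_le_of_posSemidef {X : Matrix (Fin d) (Fin d) ℝ} {r : ℝ} (hr : 0 ≤ r)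
    (h₁ : (r • (1 : Matrix (Fin d) (Fin d) ℝ) - X).PosSemidef)
    (h₂ : (X + r • (1 : Matrix (Fin d) (Fin d) ℝ)).PosSemidef) : specNorm X ≤ r := by
  have hX : X.IsHermitian := by
    have := h₂.isHermitian.sub (isHermitian_one.smul (k := r) (IsSelfAdjoint.all r))
    simpa using this
  have hev : ∀ i, |hX.eigenvalues i| ≤ r := fun i => by
    set w : Fin d → ℝ := (hX.eigenvectorBasis i).ofLp with hw
    have hww : w ⬝ᵥ w = 1 := by
      have h1 := hX.eigenvectorBasis.orthonormal.1 i
      have h2 := EuclideanSpace.real_norm_sq_eq (hX.eigenvectorBasis i)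
      rw [h1] at h2
      simpa [dotProduct, sq, hw] using h2.symm
    have hXw : X *ᵥ w = hX.eigenvalues i • w := hX.mulVec_eigenvectorBasis i
    have a₁ := h₁.dotProduct_mulVec_nonneg w
    have a₂ := h₂.dotProduct_mulVec_nonneg w
    simp only [star_trivial, sub_mulVec, add_mulVec, smul_mulVec, one_mulVec, hXw,
      dotProduct_sub, dotProduct_add, dotProduct_smul, hww, smul_eq_mul] at a₁ a₂
    rw [abs_le]
    constructor <;> linarith
  unfold specNorm
  rw [hX.spectral_theorem, Unitary.conjStarAlgAut_apply, ← Unitary.coe_star,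
    CStarRing.norm_mul_coe_unitary, CStarRing.norm_coe_unitary_mul, l2_opNorm_diagonal]
  exact (pi_norm_le_iff_of_nonneg hr).2 fun i => by simpa using hev i

end Norms
end QuadLift
end

noncomputable section

namespace QuadLift
open Matrix MeasureTheory ProbabilityTheory

/-! ### Exponential moments of quadratic functions of a standard Gaussian. -/

section GaussianIntegrals

/-- Completing the square: tilting `N(0,1)` by the quadratic exponential gives a multiple of the
density of `N(b/(1-l), 1/(1-l))`. -/
lemma exp_quadratic_mul_gaussianPDFReal {l : ℝ} (hl : l < 1) (b x : ℝ) :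
    gaussianPDFReal 0 1 x * Real.exp (b * x + l * x ^ 2 / 2) =
      Real.exp (b ^ 2 / (2 * (1 - l)) - Real.log (1 - l) / 2) *
        gaussianPDFReal (b / (1 - l)) (Real.toNNReal (1 - l)⁻¹) x := by
  have h0 : 0 < 1 - l := by linarith
  have e1 : Real.exp (-(Real.log (1 - l) / 2)) = (√(1 - l))⁻¹ := by
    rw [Real.exp_neg, ← Real.log_sqrt h0.le, Real.exp_log (Real.sqrt_pos.2 h0)]
  rw [sub_eq_add_neg _ (Real.log (1 - l) / 2), Real.exp_add (b ^ 2 / _), e1]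
  simp only [gaussianPDFReal, Real.coe_toNNReal _ (inv_pos.2 h0).le, NNReal.coe_one, sub_zero,
    mul_one]
  have e2 : √(2 * Real.pi * (1 - l)⁻¹) = √(2 * Real.pi) * (√(1 - l))⁻¹ := by
    rw [Real.sqrt_mul (by positivity), Real.sqrt_inv]
  rw [e2, mul_inv, inv_inv]
  have hs : √(1 - l) ≠ 0 := (Real.sqrt_pos.2 h0).ne'
  have e3 : Real.exp (-x ^ 2 / 2) * Real.exp (b * x + l * x ^ 2 / 2) =
      Real.exp (b ^ 2 / (2 * (1 - l))) *
        Real.exp (-(x - b / (1 - l)) ^ 2 / (2 * (1 - l)⁻¹)) := by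
    rw [← Real.exp_add, ← Real.exp_add]
    congr 1
    field_simp
    ring
  rw [mul_assoc, e3]
  field_simp

lemma integrable_exp_quadratic_gaussianReal {l : ℝ} (hl : l < 1) (b : ℝ) :
    Integrable (fun x => Real.exp (b * x + l * x ^ 2 / 2)) (gaussianReal 0 1) := by
  rw [gaussianReal_of_var_ne_zero _ one_ne_zero,
    integrable_withDensity_iff_integrable_smul' (measurable_gaussianPDF _ _)
      (by simp [gaussianPDF_lt_top])]
  simp only [toReal_gaussianPDF, smul_eq_mul, exp_quadratic_mul_gaussianPDFReal hl]
  exact (integrable_gaussianPDFReal _ _).const_mul _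

lemma integral_exp_quadratic_gaussianReal {l : ℝ} (hl : l < 1) (b : ℝ) :
    ∫ x, Real.exp (b * x + l * x ^ 2 / 2) ∂(gaussianReal 0 1) =
      Real.exp (b ^ 2 / (2 * (1 - l)) - Real.log (1 - l) / 2) := by
  have h0 : 0 < 1 - l := by linarith
  rw [integral_gaussianReal_eq_integral_smul one_ne_zero]
  simp only [smul_eq_mul, exp_quadratic_mul_gaussianPDFReal hl]
  rw [integral_const_mul, integral_gaussianPDFReal_eq_one, mul_one]
  simpa using h0

variable {d : ℕ}

/-- In an orthonormal eigenbasis of `S` the coordinates stay independent standard normals and the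
exponent separates, so the integral is a product of one-dimensional ones. -/
lemma exp_quadratic_stdGaussian {S : Matrix (Fin d) (Fin d) ℝ} (hS : S.IsHermitian)
    (hP : (1 - S).PosDef) (b : Fin d → ℝ) :
    Integrable (fun x : EuclideanSpace ℝ (Fin d) =>
      Real.exp (b ⬝ᵥ x.ofLp + (1 / 2) * (x.ofLp ⬝ᵥ S *ᵥ x.ofLp)))
        (stdGaussian (EuclideanSpace ℝ (Fin d))) ∧
    ∫ x : EuclideanSpace ℝ (Fin d),
        Real.exp (b ⬝ᵥ x.ofLp + (1 / 2) * (x.ofLp ⬝ᵥ S *ᵥ x.ofLp))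
          ∂(stdGaussian (EuclideanSpace ℝ (Fin d))) =
      Real.exp ((1 / 2) * (b ⬝ᵥ (1 - S)⁻¹ *ᵥ b) - (1 / 2) * Real.log (1 - S).det) := by
  set e := hS.eigenvectorBasis
  set l := hS.eigenvalues
  let w : Fin d → Fin d → ℝ := fun i => (e i).ofLp
  have hw : ∀ i j, w i ⬝ᵥ w j = if i = j then 1 else 0 := fun i j => by
    have := orthonormal_iff_ite.1 e.orthonormal i j
    rw [← this, PiLp.inner_apply]
    simp [dotProduct, w, mul_comm]
  have hSw : ∀ i, S *ᵥ w i = l i • w i := fun i => hS.mulVec_eigenvectorBasis i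
  have hl : ∀ i, l i < 1 := fun i => by
    have hne : w i ≠ 0 := fun h => by
      have := hw i i
      simp [h] at this
    have := hP.dotProduct_mulVec_pos hne
    simp only [star_trivial, sub_mulVec, one_mulVec, hSw, dotProduct_sub, dotProduct_smul, hw,
      if_true, smul_eq_mul] at this
    linarith
  have hsum : ∀ (x : Fin d → ℝ), (∑ i, x i • e i).ofLp = ∑ i, x i • w i := fun x => by
    simp [w, WithLp.ofLp_sum]
  have hquad : ∀ x : Fin d → ℝ, b ⬝ᵥ (∑ i, x i • e i).ofLp
      + (1 / 2) * ((∑ i, x i • e i).ofLp ⬝ᵥ S *ᵥ (∑ i, x i • e i).ofLp) =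
      ∑ i, ((b ⬝ᵥ w i) * x i + l i * x i ^ 2 / 2) := fun x => by
    rw [hsum, mulVec_sum]
    simp only [dotProduct_sum, sum_dotProduct, mulVec_smul, hSw, dotProduct_smul,
      smul_dotProduct, hw, smul_eq_mul, Finset.mul_sum, Finset.sum_add_distrib]
    congr 1
    · exact Finset.sum_congr rfl fun i _ => by ring
    · refine Finset.sum_congr rfl fun i _ => ?_
      rw [Finset.sum_eq_single i (fun j _ hj => by simp [hj]) (by simp)]
      simp
      ring
  have hb : b = ∑ i, (b ⬝ᵥ w i) • w i := by
    have h := e.sum_repr' (WithLp.toLp 2 b)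
    have h2 := congrArg WithLp.ofLp h
    rw [hsum (fun i => inner ℝ (e i) (WithLp.toLp 2 b))] at h2
    simp only at h2
    conv_lhs => rw [← h2]
    refine Finset.sum_congr rfl fun i _ => ?_
    congr 1
  have hinv : (1 - S)⁻¹ *ᵥ b = ∑ i, ((b ⬝ᵥ w i) / (1 - l i)) • w i := by
    have h1 : (1 - S) *ᵥ (∑ i, ((b ⬝ᵥ w i) / (1 - l i)) • w i) = b := by
      rw [mulVec_sum]
      conv_rhs => rw [hb]
      refine Finset.sum_congr rfl fun i _ => ?_
      rw [mulVec_smul, sub_mulVec, one_mulVec, hSw]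
      have : 1 - l i ≠ 0 := (sub_pos.2 (hl i)).ne'
      rw [show w i - l i • w i = (1 - l i) • w i by rw [sub_smul, one_smul], smul_smul,
        div_mul_cancel₀ _ this]
    conv_lhs => rw [← h1]
    rw [mulVec_mulVec, nonsing_inv_mul _ (isUnit_iff_ne_zero.2 hP.det_pos.ne'), one_mulVec]
  have hbb : b ⬝ᵥ (1 - S)⁻¹ *ᵥ b = ∑ i, (b ⬝ᵥ w i) ^ 2 / (1 - l i) := by
    rw [hinv]
    simp only [dotProduct_sum, dotProduct_smul, smul_eq_mul]
    exact Finset.sum_congr rfl fun i _ => by ring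
  have hdet : (1 - S).det = ∏ i, (1 - l i) := by
    have h1 : (1 - S).det = S.charpoly.eval 1 := by
      rw [eval_charpoly]
      simp
    rw [h1, hS.charpoly_eq]
    simp [Polynomial.eval_prod, l]
  have hmap := stdGaussian_eq_map_pi_orthonormalBasis e
  have hmeas : AEMeasurable (fun x : Fin d → ℝ => ∑ i, x i • e i)
      (Measure.pi fun _ : Fin d => gaussianReal 0 1) :=
    Continuous.aemeasurable (by fun_prop)
  have hint : Integrable (fun x : Fin d → ℝ =>
      ∏ i, Real.exp ((b ⬝ᵥ w i) * x i + l i * x i ^ 2 / 2))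
      (Measure.pi fun _ : Fin d => gaussianReal 0 1) :=
    Integrable.fintype_prod fun i => integrable_exp_quadratic_gaussianReal (hl i) (b ⬝ᵥ w i)
  have hcont : Continuous (fun x : EuclideanSpace ℝ (Fin d) =>
      Real.exp (b ⬝ᵥ x.ofLp + (1 / 2) * (x.ofLp ⬝ᵥ S *ᵥ x.ofLp))) := by
    unfold dotProduct mulVec dotProduct
    fun_prop
  rw [hmap]
  constructor
  · rw [integrable_map_measure hcont.aestronglyMeasurable hmeas]
    simpa only [Function.comp_def, hquad, Real.exp_sum] using hint
  · rw [integral_map hmeas hcont.aestronglyMeasurable]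
    simp only [hquad, Real.exp_sum]
    rw [integral_fintype_prod_eq_prod
      (f := fun i x => Real.exp ((b ⬝ᵥ w i) * x + l i * x ^ 2 / 2))]
    simp only [integral_exp_quadratic_gaussianReal (hl _)]
    rw [← Real.exp_sum, hbb, hdet, Real.log_prod (fun i _ => (sub_pos.2 (hl i)).ne')]
    congr 1
    rw [Finset.mul_sum, Finset.mul_sum, ← Finset.sum_sub_distrib]
    refine Finset.sum_congr rfl fun i _ => ?_
    have : 1 - l i ≠ 0 := (sub_pos.2 (hl i)).ne'
    field_simp

end GaussianIntegrals
end QuadLift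
end

noncomputable section

namespace QuadLift
open Matrix MeasureTheory ProbabilityTheory

/-! ### Square roots of positive matrices. -/

section Sqrt
variable {d : ℕ} {A : Matrix (Fin d) (Fin d) ℝ}

lemma transpose_sqrt (A : Matrix (Fin d) (Fin d) ℝ) : (CFC.sqrt A)ᵀ = CFC.sqrt A := by
  have : (CFC.sqrt A)ᴴ = CFC.sqrt A := (CFC.sqrt_nonneg A).isSelfAdjoint
  simpa using this

lemma sqrt_mul_sqrt (hA : A.PosSemidef) : CFC.sqrt A * CFC.sqrt A = A :=
  CFC.sqrt_mul_sqrt_self _ hA.nonneg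

lemma isUnit_det_sqrt (hA : A.PosDef) : IsUnit (CFC.sqrt A).det := by
  rw [isUnit_iff_ne_zero]
  intro h0
  have h := congrArg det (sqrt_mul_sqrt hA.posSemidef)
  rw [det_mul, h0, mul_zero] at h
  exact hA.det_pos.ne h

lemma inv_eq_sqrt_inv_mul (hA : A.PosDef) : A⁻¹ = (CFC.sqrt A)⁻¹ * (CFC.sqrt A)⁻¹ := by
  rw [← Matrix.mul_inv_rev, sqrt_mul_sqrt hA.posSemidef]

lemma sqrt_mul_inv_mul_sqrt (hA : A.PosDef) : CFC.sqrt A * A⁻¹ * CFC.sqrt A = 1 := by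
  have hu := isUnit_det_sqrt hA
  rw [inv_eq_sqrt_inv_mul hA, ← mul_assoc, mul_nonsing_inv _ hu, one_mul, nonsing_inv_mul _ hu]

lemma transpose_sqrt_inv (A : Matrix (Fin d) (Fin d) ℝ) :
    ((CFC.sqrt A)⁻¹)ᵀ = (CFC.sqrt A)⁻¹ := by
  rw [transpose_nonsing_inv, transpose_sqrt]

lemma posSemidef_sqrt_conj {X : Matrix (Fin d) (Fin d) ℝ} (hX : X.PosSemidef)
    (A : Matrix (Fin d) (Fin d) ℝ) : (CFC.sqrt A * X * CFC.sqrt A).PosSemidef := by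
  have := hX.mul_mul_conjTranspose_same (CFC.sqrt A)
  rwa [conjTranspose_eq_transpose_of_trivial, transpose_sqrt] at this

end Sqrt

/-! ### The admissible set of matrices `H`. -/

section Domain
variable {d : ℕ} {Θs H : Matrix (Fin d) (Fin d) ℝ} {γ : ℝ}

/-- `-γ Θ_*⁻¹ ⪯ H ⪯ γ Θ_*⁻¹`. -/
structure InDomain (Θs : Matrix (Fin d) (Fin d) ℝ) (γ : ℝ) (H : Matrix (Fin d) (Fin d) ℝ) :
    Prop where
  lower : (H + γ • Θs⁻¹).PosSemidef
  upper : (γ • Θs⁻¹ - H).PosSemidef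

lemma InDomain.convex {H₀ H₁ : Matrix (Fin d) (Fin d) ℝ} (h₀ : InDomain Θs γ H₀)
    (h₁ : InDomain Θs γ H₁) {t s : ℝ} (ht : 0 ≤ t) (hs : 0 ≤ s) (hts : t + s = 1) :
    InDomain Θs γ (t • H₀ + s • H₁) := by
  obtain rfl : s = 1 - t := by linarith
  constructor
  · have := (h₀.lower.smul ht).add (h₁.lower.smul hs)
    convert this using 1
    module
  · have := (h₀.upper.smul ht).add (h₁.upper.smul hs)
    convert this using 1
    module

lemma InDomain.isHermitian (hΘ : Θs.PosDef) (h : InDomain Θs γ H) : H.IsHermitian := by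
  have := h.lower.isHermitian.sub (hΘ.inv.isHermitian.smul (k := γ) (IsSelfAdjoint.all γ))
  simpa using this

lemma InDomain.posDef_inv_sub (hΘ : Θs.PosDef) (hγ : γ < 1) (h : InDomain Θs γ H) :
    (Θs⁻¹ - H).PosDef := by
  have e : Θs⁻¹ - H = (1 - γ) • Θs⁻¹ + (γ • Θs⁻¹ - H) := by module
  rw [e]
  exact (hΘ.inv.smul (sub_pos.2 hγ)).add_posSemidef h.upper

lemma InDomain.isHermitian_conj (hΘ : Θs.PosDef) (h : InDomain Θs γ H)
    (A : Matrix (Fin d) (Fin d) ℝ) : (CFC.sqrt A * H * CFC.sqrt A).IsHermitian := by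
  have hH : Hᵀ = H := by
    simpa [IsHermitian] using h.isHermitian hΘ
  rw [IsHermitian, conjTranspose_eq_transpose_of_trivial, transpose_mul, transpose_mul, hH,
    transpose_sqrt, mul_assoc]

lemma InDomain.specNorm_le (hΘ : Θs.PosDef) (hγ : 0 ≤ γ) (h : InDomain Θs γ H) :
    specNorm (CFC.sqrt Θs * H * CFC.sqrt Θs) ≤ γ := by
  have e := sqrt_mul_inv_mul_sqrt hΘ
  refine specNorm_le_of_posSemidef hγ ?_ ?_
  · have := posSemidef_sqrt_conj h.upper Θs
    rwa [mul_sub, sub_mul, mul_smul_comm, smul_mul_assoc, e] at this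
  · have := posSemidef_sqrt_conj h.lower Θs
    rwa [mul_add, add_mul, mul_smul_comm, smul_mul_assoc, e] at this

lemma InDomain.posDef_one_sub (hΘ : Θs.PosDef) (hγ₀ : 0 ≤ γ) (hγ : γ < 1) (h : InDomain Θs γ H) :
    (1 - CFC.sqrt Θs * H * CFC.sqrt Θs).PosDef :=
  QuadLift.posDef_one_sub (h.isHermitian_conj hΘ _) ((h.specNorm_le hΘ hγ₀).trans_lt hγ)

end Domain

/-! ### Replacing the true covariance by `Θ_*` in the log-determinant. -/

section Comparison
variable {d : ℕ} {Θs Θ H : Matrix (Fin d) (Fin d) ℝ} {γ δ : ℝ}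

lemma specNorm_ratio_le_one (hΘs : Θs.PosDef) (hΘ : Θ.PosSemidef) (hle : (Θs - Θ).PosSemidef) :
    specNorm (CFC.sqrt Θ * (CFC.sqrt Θs)⁻¹) ≤ 1 := by
  refine specNorm_le_of_mulVec zero_le_one fun v => ?_
  set R := CFC.sqrt Θs
  have hu := isUnit_det_sqrt hΘs
  have h := hle.dotProduct_mulVec_nonneg (R⁻¹ *ᵥ v)
  have e1 : ∀ A : Matrix (Fin d) (Fin d) ℝ, A.PosSemidef → ∀ x : Fin d → ℝ,
      x ⬝ᵥ A *ᵥ x = (CFC.sqrt A *ᵥ x) ⬝ᵥ (CFC.sqrt A *ᵥ x) := fun A hA x => by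
    conv_lhs => rw [← sqrt_mul_sqrt hA, ← mulVec_mulVec, dotProduct_mulVec, ← mulVec_transpose,
      transpose_sqrt]
  rw [star_trivial, sub_mulVec, dotProduct_sub, e1 Θs hΘs.posSemidef, e1 Θ hΘ, mulVec_mulVec,
    mulVec_mulVec, mul_nonsing_inv _ hu, one_mulVec] at h
  linarith

lemma conj_sqrt_eq (hΘs : Θs.PosDef) (Θ H : Matrix (Fin d) (Fin d) ℝ) :
    CFC.sqrt Θ * H * CFC.sqrt Θ =
      (CFC.sqrt Θ * (CFC.sqrt Θs)⁻¹) * (CFC.sqrt Θs * H * CFC.sqrt Θs) *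
        (CFC.sqrt Θ * (CFC.sqrt Θs)⁻¹)ᵀ := by
  have hu := isUnit_det_sqrt hΘs
  rw [transpose_mul, transpose_sqrt, transpose_sqrt_inv]
  calc CFC.sqrt Θ * H * CFC.sqrt Θ
      = CFC.sqrt Θ * ((CFC.sqrt Θs)⁻¹ * CFC.sqrt Θs) * H *
          (CFC.sqrt Θs * (CFC.sqrt Θs)⁻¹) * CFC.sqrt Θ := by
        rw [mul_nonsing_inv _ hu, nonsing_inv_mul _ hu]; simp
    _ = _ := by simp only [mul_assoc]

lemma specNorm_conj_le {W L : Matrix (Fin d) (Fin d) ℝ} (hW : specNorm W ≤ 1) :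
    specNorm (W * L * Wᵀ) ≤ specNorm L := by
  have hW' : specNorm Wᵀ ≤ 1 := (specNorm_transpose W).trans_le hW
  have hL := specNorm_nonneg L
  calc specNorm (W * L * Wᵀ) ≤ specNorm (W * L) * specNorm Wᵀ := specNorm_mul_le _ _
    _ ≤ (specNorm W * specNorm L) * 1 :=
        mul_le_mul (specNorm_mul_le _ _) hW' (specNorm_nonneg _)
          (mul_nonneg (specNorm_nonneg _) hL)
    _ ≤ specNorm L := by nlinarith

lemma frob_conj_le {W L : Matrix (Fin d) (Fin d) ℝ} (hW : specNorm W ≤ 1) :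
    frob (W * L * Wᵀ) ≤ frob L := by
  have hW' : specNorm Wᵀ ≤ 1 := (specNorm_transpose W).trans_le hW
  have hL := frob_nonneg L
  calc frob (W * L * Wᵀ) ≤ frob (W * L) * specNorm Wᵀ := frob_mul_le' _ _
    _ ≤ (specNorm W * frob L) * 1 :=
        mul_le_mul (frob_mul_le _ _) hW' (specNorm_nonneg _)
          (mul_nonneg (specNorm_nonneg _) hL)
    _ ≤ frob L := by nlinarith

/-- With `D = W - 1` the difference is `DL + LDᵀ + DLDᵀ`, which costs `2δ + δ²`. -/
lemma frob_conj_sub_le {W L : Matrix (Fin d) (Fin d) ℝ} (hδ : 0 ≤ δ)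
    (hW : specNorm (W - 1) ≤ δ) :
    frob (W * L * Wᵀ - L) ≤ δ * (2 + δ) * frob L := by
  set D := W - 1 with hD
  have hDt : specNorm Dᵀ ≤ δ := (specNorm_transpose D).trans_le hW
  have e : W * L * Wᵀ - L = D * L + L * Dᵀ + D * L * Dᵀ := by
    rw [show W = D + 1 by simp [hD], transpose_add, transpose_one]
    noncomm_ring
  have hL := frob_nonneg L
  have b1 : frob (D * L) ≤ δ * frob L :=
    (frob_mul_le _ _).trans (mul_le_mul_of_nonneg_right hW hL)
  have b2 : frob (L * Dᵀ) ≤ frob L * δ :=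
    (frob_mul_le' _ _).trans (mul_le_mul_of_nonneg_left hDt hL)
  have b3 : frob (D * L * Dᵀ) ≤ (δ * frob L) * δ :=
    (frob_mul_le' _ _).trans (mul_le_mul b1 hDt (specNorm_nonneg _) (by positivity))
  rw [e]
  calc _ ≤ frob (D * L) + frob (L * Dᵀ) + frob (D * L * Dᵀ) :=
        (frob_add_le _ _).trans (add_le_add_left (frob_add_le _ _) _)
    _ ≤ δ * frob L + frob L * δ + (δ * frob L) * δ := by gcongr
    _ = _ := by ring

/-- The resolvent remainder `N` satisfies `N = X + XN`, so its Frobenius norm can be absorbed on the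
left when `‖X‖ < 1`. -/
lemma frob_resolvent_le {X : Matrix (Fin d) (Fin d) ℝ} {r f : ℝ} (hu : IsUnit (1 - X).det)
    (hr : specNorm X ≤ r) (hr1 : r < 1) (hf : frob X ≤ f) :
    frob ((1 - X)⁻¹ - 1) ≤ f / (1 - r) := by
  set N := (1 - X)⁻¹ - 1 with hN
  have e : N = X + X * N := by
    have h1 : (1 - X) * (1 - X)⁻¹ = 1 := mul_nonsing_inv _ hu
    have h2 : (1 - X)⁻¹ = N + 1 := by simp [hN]
    rw [h2] at h1
    have h3 : (1 - X) * (N + 1) = 1 + (N - (X + X * N)) := by noncomm_ring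
    rw [h3] at h1
    exact sub_eq_zero.1 (add_eq_left.1 h1)
  have h1 : frob N ≤ frob X + specNorm X * frob N := by
    conv_lhs => rw [e]
    exact (frob_add_le _ _).trans (add_le_add_right (frob_mul_le _ _) _)
  have h2 : specNorm X * frob N ≤ r * frob N := mul_le_mul_of_nonneg_right hr (frob_nonneg _)
  rw [le_div_iff₀ (by linarith)]
  linarith

/-- Writing `X = WLWᵀ` with the contraction `W = Θ^{1/2}Θ_*^{-1/2}`, the bound splits into the value
at `L`, the linear term `Tr(X - L) = Tr((Θ - Θ_*)H)`, and a remainder handled by Cauchy–Schwarz. -/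
lemma neg_half_log_det_le_Upsilon (hΘs : Θs.PosDef) (hΘ : Θ.PosSemidef)
    (hle : (Θs - Θ).PosSemidef) (hδ : 0 ≤ δ)
    (hclose : specNorm (CFC.sqrt Θ * (CFC.sqrt Θs)⁻¹ - 1) ≤ δ)
    (hγ₀ : 0 ≤ γ) (hγ : γ < 1) (h : InDomain Θs γ H) :
    (1 - CFC.sqrt Θ * H * CFC.sqrt Θ).PosDef ∧
    -(1 / 2) * Real.log (1 - CFC.sqrt Θ * H * CFC.sqrt Θ).det ≤ Upsilon Θs δ H Θ := by
  set W := CFC.sqrt Θ * (CFC.sqrt Θs)⁻¹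
  set X := CFC.sqrt Θ * H * CFC.sqrt Θ with hX
  set L := CFC.sqrt Θs * H * CFC.sqrt Θs with hL
  have hXW : X = W * L * Wᵀ := conj_sqrt_eq hΘs Θ H
  have hW : specNorm W ≤ 1 := specNorm_ratio_le_one hΘs hΘ hle
  have hLγ : specNorm L < 1 := (h.specNorm_le hΘs hγ₀).trans_lt hγ
  have hXL : specNorm X ≤ specNorm L := hXW ▸ specNorm_conj_le hW
  have hP : (1 - X).PosDef := posDef_one_sub (h.isHermitian_conj hΘs _) (hXL.trans_lt hLγ)
  refine ⟨hP, ?_⟩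
  -- The tangent is taken at `1 - X`, not at `1 - L`: only this choice bounds `-log det(1 - X)` from
  -- above.
  have key := log_det_le_add_trace hP (h.posDef_one_sub hΘs hγ₀ hγ)
  rw [← hL] at key
  have hN := frob_resolvent_le (isUnit_iff_ne_zero.2 hP.det_pos.ne') hXL hLγ
    (hXW ▸ frob_conj_le hW : frob X ≤ frob L)
  have hF : frob (X - L) ≤ δ * (2 + δ) * frob L := hXW ▸ frob_conj_sub_le hδ hclose
  have e1 : ((1 - X)⁻¹ * (1 - L - (1 - X))).trace =
      X.trace - L.trace + (((1 - X)⁻¹ - 1) * (X - L)).trace := by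
    rw [← trace_sub, ← trace_add]
    congr 1
    noncomm_ring
  have e2 : X.trace = (Θ * H).trace := by
    rw [hX, trace_mul_cycle, sqrt_mul_sqrt hΘ]
  have e3 : L.trace = (Θs * H).trace := by
    rw [hL, trace_mul_cycle, sqrt_mul_sqrt hΘs.posSemidef]
  have b : (((1 - X)⁻¹ - 1) * (X - L)).trace ≤
      frob L / (1 - specNorm L) * (δ * (2 + δ) * frob L) :=
    (trace_mul_le_frob _ _).trans
      (mul_le_mul hN hF (frob_nonneg _) (div_nonneg (frob_nonneg _) (by linarith)))
  have e4 : δ * (2 + δ) / (2 * (1 - specNorm L)) * frobSq L =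
      (1 / 2) * (frob L / (1 - specNorm L) * (δ * (2 + δ) * frob L)) := by
    rw [← frob_sq]
    have : 1 - specNorm L ≠ 0 := by linarith
    field_simp
  rw [e1, e2, e3] at key
  rw [Upsilon, ← hL, e4, sub_mul, trace_sub]
  linarith

end Comparison

/-! ### The exponential moment of one observation. -/

section ExpMoment
variable {d : ℕ} {Θs Θ H : Matrix (Fin d) (Fin d) ℝ} {γ δ : ℝ}

lemma Gam_rankOne (Θs H : Matrix (Fin d) (Fin d) ℝ) (h μ : Fin d → ℝ) :
    Gam Θs h H (vecMulVec (lift1 μ) (lift1 μ)) =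
      h ⬝ᵥ μ + (1 / 2) * (μ ⬝ᵥ H *ᵥ μ)
        + (1 / 2) * ((H *ᵥ μ + h) ⬝ᵥ (Θs⁻¹ - H)⁻¹ *ᵥ (H *ᵥ μ + h)) := by
  have e1 : rowBlock h H *ᵥ lift1 μ = H *ᵥ μ + h := by
    ext i
    simp [rowBlock, lift1, mulVec, dotProduct, Fintype.sum_sum_type]
  have e2 : lift1 μ ⬝ᵥ (fromBlocks H (replicateCol Unit h) (replicateRow Unit h) 0) *ᵥ lift1 μ =
      μ ⬝ᵥ H *ᵥ μ + 2 * (h ⬝ᵥ μ) := by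
    simp [lift1, mulVec, dotProduct, Fintype.sum_sum_type, mul_add, Finset.sum_add_distrib]
    rw [two_mul, add_assoc]
    congr 2
    exact Finset.sum_congr rfl fun i _ => mul_comm _ _
  rw [Gam, vecMulVec_mul, trace_vecMulVec, dotProduct_comm, ← dotProduct_mulVec, add_mulVec, dotProduct_add, e2,
    ← mulVec_mulVec, ← mulVec_mulVec, e1, dotProduct_mulVec (lift1 μ), vecMul_transpose, e1]
  ring

lemma exp_moment_le_Phi (hΘs : Θs.PosDef) (hΘ : Θ.PosSemidef)
    (hle : (Θs - Θ).PosSemidef) (hδ : 0 ≤ δ)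
    (hclose : specNorm (CFC.sqrt Θ * (CFC.sqrt Θs)⁻¹ - 1) ≤ δ)
    (hγ₀ : 0 ≤ γ) (hγ : γ < 1) (hH : InDomain Θs γ H) (h μ : Fin d → ℝ) :
    Integrable (fun ζ : EuclideanSpace ℝ (Fin d) =>
      Real.exp (h ⬝ᵥ ζ.ofLp + (1 / 2) * (ζ.ofLp ⬝ᵥ H *ᵥ ζ.ofLp)))
        (multivariateGaussian (WithLp.toLp 2 μ) Θ) ∧
    ∫ ζ : EuclideanSpace ℝ (Fin d),
        Real.exp (h ⬝ᵥ ζ.ofLp + (1 / 2) * (ζ.ofLp ⬝ᵥ H *ᵥ ζ.ofLp))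
          ∂(multivariateGaussian (WithLp.toLp 2 μ) Θ) ≤
      Real.exp (Phi Θs δ h H Θ (vecMulVec (lift1 μ) (lift1 μ))) := by
  obtain ⟨hP, hΥ⟩ := neg_half_log_det_le_Upsilon hΘs hΘ hle hδ hclose hγ₀ hγ hH
  set T := CFC.sqrt Θ with hT
  have hTt : Tᵀ = T := transpose_sqrt Θ
  have hHh := hH.isHermitian hΘs
  set c := H *ᵥ μ + h with hc
  have hTdot : ∀ x y : Fin d → ℝ, x ⬝ᵥ T *ᵥ y = (T *ᵥ x) ⬝ᵥ y := fun x y => by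
    rw [dotProduct_mulVec, ← mulVec_transpose, hTt]
  obtain ⟨hint, hval⟩ := exp_quadratic_stdGaussian (hH.isHermitian_conj hΘs Θ) hP (T *ᵥ c)
  rw [← hT] at hint hval
  have hexp : ∀ x : EuclideanSpace ℝ (Fin d),
      h ⬝ᵥ (WithLp.toLp 2 μ + toEuclideanCLM (𝕜 := ℝ) T x).ofLp + (1 / 2) *
        ((WithLp.toLp 2 μ + toEuclideanCLM (𝕜 := ℝ) T x).ofLp ⬝ᵥ
          H *ᵥ (WithLp.toLp 2 μ + toEuclideanCLM (𝕜 := ℝ) T x).ofLp) =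
      (h ⬝ᵥ μ + (1 / 2) * (μ ⬝ᵥ H *ᵥ μ)) +
        ((T *ᵥ c) ⬝ᵥ x.ofLp + (1 / 2) * (x.ofLp ⬝ᵥ (T * H * T) *ᵥ x.ofLp)) := fun x => by
    have e : (WithLp.toLp 2 μ + toEuclideanCLM (𝕜 := ℝ) T x).ofLp = μ + T *ᵥ x.ofLp := by
      simp [ofLp_toEuclideanCLM]
    rw [e, ← hTdot, ← mulVec_mulVec, ← mulVec_mulVec, hTdot x.ofLp]
    simp only [hc, add_dotProduct, dotProduct_add, mulVec_add]
    rw [dotProduct_mulVec_symm hHh (T *ᵥ x.ofLp) μ,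
      dotProduct_comm (H *ᵥ μ), dotProduct_mulVec_symm hHh (T *ᵥ x.ofLp) μ]
    ring
  have hmeas : AEMeasurable (fun x : EuclideanSpace ℝ (Fin d) =>
      WithLp.toLp 2 μ + toEuclideanCLM (𝕜 := ℝ) T x) (stdGaussian (EuclideanSpace ℝ (Fin d))) :=
    Continuous.aemeasurable (by fun_prop)
  have hcont : Continuous (fun x : EuclideanSpace ℝ (Fin d) =>
      Real.exp (h ⬝ᵥ x.ofLp + (1 / 2) * (x.ofLp ⬝ᵥ H *ᵥ x.ofLp))) := by
    unfold dotProduct mulVec dotProduct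
    fun_prop
  unfold multivariateGaussian
  rw [← hT]
  constructor
  · rw [integrable_map_measure hcont.aestronglyMeasurable hmeas]
    simp only [Function.comp_def, hexp, Real.exp_add (h ⬝ᵥ μ + _)]
    exact hint.const_mul _
  · rw [integral_map hmeas hcont.aestronglyMeasurable]
    simp only [hexp, Real.exp_add (h ⬝ᵥ μ + _)]
    rw [integral_const_mul, hval, ← Real.exp_add, Real.exp_le_exp, Phi, Gam_rankOne, ← hc]
    have hquad : (T *ᵥ c) ⬝ᵥ (1 - T * H * T)⁻¹ *ᵥ (T *ᵥ c) ≤ c ⬝ᵥ (Θs⁻¹ - H)⁻¹ *ᵥ c := by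
      rw [inv_quadratic_eq hP]
      set x := (1 - T * H * T)⁻¹ *ᵥ (T *ᵥ c)
      -- `Θ` may be singular, so the inverses are compared variationally: the maximizer `x` on the
      -- left yields the test vector `Tx` on the right, leaving only `(Tx)ᵀΘ_*⁻¹(Tx) ≤ xᵀx`.
      refine le_trans ?_ (le_inv_quadratic (hH.posDef_inv_sub hΘs hγ) c (T *ᵥ x))
      have hW := sum_mulVec_sq_le (T * (CFC.sqrt Θs)⁻¹)ᵀ x
      have hW1 : specNorm (T * (CFC.sqrt Θs)⁻¹)ᵀ ≤ 1 :=
        (specNorm_transpose _).trans_le (specNorm_ratio_le_one hΘs hΘ hle)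
      have hx : 0 ≤ x ⬝ᵥ x := by simpa using dotProduct_star_self_nonneg x
      have hW2 : specNorm (T * (CFC.sqrt Θs)⁻¹)ᵀ ^ 2 * (x ⬝ᵥ x) ≤ x ⬝ᵥ x :=
        mul_le_of_le_one_left hx (pow_le_one₀ (specNorm_nonneg _) hW1)
      have e1 : (T *ᵥ x) ⬝ᵥ Θs⁻¹ *ᵥ (T *ᵥ x) =
          ((T * (CFC.sqrt Θs)⁻¹)ᵀ *ᵥ x) ⬝ᵥ ((T * (CFC.sqrt Θs)⁻¹)ᵀ *ᵥ x) := by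
        rw [inv_eq_sqrt_inv_mul hΘs, ← mulVec_mulVec, dotProduct_mulVec, ← mulVec_transpose,
          transpose_sqrt_inv, transpose_mul, hTt, transpose_sqrt_inv, ← mulVec_mulVec]
      have e2 : x ⬝ᵥ (T * H * T) *ᵥ x = (T *ᵥ x) ⬝ᵥ H *ᵥ (T *ᵥ x) := by
        rw [← mulVec_mulVec, ← mulVec_mulVec, hTdot]
      rw [← hTdot, sub_mulVec, sub_mulVec, dotProduct_sub, dotProduct_sub, one_mulVec, e1, e2]
      linarith
    linarith

end ExpMoment
end QuadLift
end

noncomputable section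

namespace QuadLift
open Matrix MeasureTheory ProbabilityTheory

/-! ### Convexity of `Phi` and a linear minorant. -/

section Convexity
variable {d : ℕ} {Θs : Matrix (Fin d) (Fin d) ℝ} {γ δ : ℝ}

/-- Quadratic-over-linear is jointly convex and, for `f ≥ 0` and `r < 1`, increasing in both
arguments, so convex bounds on `f` and `r` can be inserted. -/
lemma sq_div_one_sub_convex {f₀ f₁ f r₀ r₁ r t s : ℝ} (ht : 0 ≤ t) (hs : 0 ≤ s)
    (hts : t + s = 1) (h₀ : r₀ < 1) (h₁ : r₁ < 1) (hf0 : 0 ≤ f) (hf : f ≤ t * f₀ + s * f₁)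
    (hr : r ≤ t * r₀ + s * r₁) :
    f ^ 2 / (1 - r) ≤ t * (f₀ ^ 2 / (1 - r₀)) + s * (f₁ ^ 2 / (1 - r₁)) := by
  have p₀ : 0 < 1 - r₀ := by linarith
  have p₁ : 0 < 1 - r₁ := by linarith
  have hD : 0 < t * (1 - r₀) + s * (1 - r₁) := by
    rcases ht.eq_or_lt with rfl | ht
    · obtain rfl : s = 1 := by linarith
      simpa using p₁
    · have := mul_pos ht p₀
      have := mul_nonneg hs p₁.le
      linarith
  have hDr : t * (1 - r₀) + s * (1 - r₁) ≤ 1 - r := by nlinarith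
  calc f ^ 2 / (1 - r) ≤ (t * f₀ + s * f₁) ^ 2 / (t * (1 - r₀) + s * (1 - r₁)) :=
        div_le_div₀ (sq_nonneg _) (pow_le_pow_left₀ hf0 hf 2) hD hDr
    _ ≤ _ := by
        rw [div_le_iff₀ hD]
        have e₀ : f₀ ^ 2 = (f₀ / (1 - r₀)) ^ 2 * (1 - r₀) ^ 2 := by field_simp
        have e₁ : f₁ ^ 2 = (f₁ / (1 - r₁)) ^ 2 * (1 - r₁) ^ 2 := by field_simp
        have key : 0 ≤ t * s * ((1 - r₀) * (1 - r₁)) * (f₀ / (1 - r₀) - f₁ / (1 - r₁)) ^ 2 := by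
          positivity
        have expand : (t * (f₀ ^ 2 / (1 - r₀)) + s * (f₁ ^ 2 / (1 - r₁))) *
            (t * (1 - r₀) + s * (1 - r₁)) - (t * f₀ + s * f₁) ^ 2 =
            t * s * ((1 - r₀) * (1 - r₁)) * (f₀ / (1 - r₀) - f₁ / (1 - r₁)) ^ 2 := by
          field_simp
          ring
        linarith

lemma Upsilon_convex (hΘs : Θs.PosDef) (hδ : 0 ≤ δ) (hγ₀ : 0 ≤ γ) (hγ : γ < 1)
    {H₀ H₁ : Matrix (Fin d) (Fin d) ℝ} (h₀ : InDomain Θs γ H₀) (h₁ : InDomain Θs γ H₁)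
    {t s : ℝ} (ht : 0 ≤ t) (hs : 0 ≤ s) (hts : t + s = 1) (Θ : Matrix (Fin d) (Fin d) ℝ) :
    Upsilon Θs δ (t • H₀ + s • H₁) Θ ≤ t * Upsilon Θs δ H₀ Θ + s * Upsilon Θs δ H₁ Θ := by
  have hD := h₀.convex h₁ ht hs hts
  have p₀ := h₀.posDef_one_sub hΘs hγ₀ hγ
  have p₁ := h₁.posDef_one_sub hΘs hγ₀ hγ
  have p := hD.posDef_one_sub hΘs hγ₀ hγ
  have n₀ := (h₀.specNorm_le hΘs hγ₀).trans_lt hγ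
  have n₁ := (h₁.specNorm_le hΘs hγ₀).trans_lt hγ
  have eL : CFC.sqrt Θs * (t • H₀ + s • H₁) * CFC.sqrt Θs =
      t • (CFC.sqrt Θs * H₀ * CFC.sqrt Θs) + s • (CFC.sqrt Θs * H₁ * CFC.sqrt Θs) := by
    simp only [mul_add, add_mul, mul_smul_comm, smul_mul_assoc]
  simp only [Upsilon]
  rw [eL] at p ⊢
  set L₀ := CFC.sqrt Θs * H₀ * CFC.sqrt Θs
  set L₁ := CFC.sqrt Θs * H₁ * CFC.sqrt Θs
  set P := 1 - (t • L₀ + s • L₁) with hP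
  have l₀ := mul_le_mul_of_nonneg_left (log_det_le_add_trace p p₀) ht
  have l₁ := mul_le_mul_of_nonneg_left (log_det_le_add_trace p p₁) hs
  have hlog : t * Real.log (1 - L₀).det + s * Real.log (1 - L₁).det ≤ Real.log P.det := by
    have e : t * (P⁻¹ * (1 - L₀ - P)).trace + s * (P⁻¹ * (1 - L₁ - P)).trace = 0 := by
      have h1 : t • (1 - L₀ - P) + s • (1 - L₁ - P) = 0 := by
        obtain rfl : s = 1 - t := by linarith
        rw [hP]
        module
      have h2 := congrArg (fun Y => (P⁻¹ * Y).trace) h1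
      simpa only [mul_add, mul_smul_comm, trace_add, trace_smul, smul_eq_mul, mul_zero,
        trace_zero] using h2
    have e2 : t * Real.log P.det + s * Real.log P.det = Real.log P.det := by
      rw [← add_mul, hts, one_mul]
    linarith
  have hquad := sq_div_one_sub_convex ht hs hts n₀ n₁ (frob_nonneg (t • L₀ + s • L₁))
    (by
      refine (frob_add_le _ _).trans_eq ?_
      rw [frob_smul ht, frob_smul hs])
    (by
      refine (specNorm_add_le (t • L₀) (s • L₁)).trans_eq ?_
      rw [specNorm_smul ht, specNorm_smul hs])
  simp only [frob_sq] at hquad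
  have hδ' : 0 ≤ δ * (2 + δ) / 2 := by positivity
  have hq := mul_le_mul_of_nonneg_left hquad hδ'
  have e : ∀ r x : ℝ, δ * (2 + δ) / (2 * (1 - r)) * x = δ * (2 + δ) / 2 * (x / (1 - r)) :=
    fun r x => by rw [← div_div]; ring
  rw [e, e, e]
  have elin : ((Θ - Θs) * (t • H₀ + s • H₁)).trace =
      t * ((Θ - Θs) * H₀).trace + s * ((Θ - Θs) * H₁).trace := by
    simp [mul_add]
  rw [elin]
  linarith

/-- The symmetric matrix `[H, h; hᵀ, 0]`. -/
def borderBlock (h : Fin d → ℝ) (H : Matrix (Fin d) (Fin d) ℝ) :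
    Matrix (Fin d ⊕ Unit) (Fin d ⊕ Unit) ℝ :=
  fromBlocks H (replicateCol Unit h) (replicateRow Unit h) 0

lemma borderBlock_smul (a : ℝ) (h : Fin d → ℝ) (H : Matrix (Fin d) (Fin d) ℝ) :
    borderBlock (a • h) (a • H) = a • borderBlock h H := by
  simp [borderBlock, fromBlocks_smul]

lemma borderBlock_add (h₀ h₁ : Fin d → ℝ) (H₀ H₁ : Matrix (Fin d) (Fin d) ℝ) :
    borderBlock (h₀ + h₁) (H₀ + H₁) = borderBlock h₀ H₀ + borderBlock h₁ H₁ := by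
  simp [borderBlock, fromBlocks_add]

lemma rowBlock_smul (a : ℝ) (h : Fin d → ℝ) (H : Matrix (Fin d) (Fin d) ℝ) :
    rowBlock (a • h) (a • H) = a • rowBlock h H := by
  ext i (j | j) <;> simp [rowBlock]

lemma rowBlock_add (h₀ h₁ : Fin d → ℝ) (H₀ H₁ : Matrix (Fin d) (Fin d) ℝ) :
    rowBlock (h₀ + h₁) (H₀ + H₁) = rowBlock h₀ H₀ + rowBlock h₁ H₁ := by
  ext i (j | j) <;> simp [rowBlock]

lemma Gam_eq (Θs : Matrix (Fin d) (Fin d) ℝ) (h : Fin d → ℝ) (H : Matrix (Fin d) (Fin d) ℝ)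
    (Z : Matrix (Fin d ⊕ Unit) (Fin d ⊕ Unit) ℝ) :
    Gam Θs h H Z = (1 / 2) * (Z * borderBlock h H).trace +
      (1 / 2) * (Z * ((rowBlock h H)ᵀ * (Θs⁻¹ - H)⁻¹ * rowBlock h H)).trace := by
  rw [Gam, mul_add, trace_add, mul_add]
  rfl

lemma Gam_convex (hΘs : Θs.PosDef) (hγ : γ < 1)
    {H₀ H₁ : Matrix (Fin d) (Fin d) ℝ} (h₀ : InDomain Θs γ H₀) (h₁ : InDomain Θs γ H₁)
    {t s : ℝ} (ht : 0 ≤ t) (hs : 0 ≤ s) (hts : t + s = 1) (x₀ x₁ : Fin d → ℝ)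
    {Z : Matrix (Fin d ⊕ Unit) (Fin d ⊕ Unit) ℝ} (hZ : Z.PosSemidef) :
    Gam Θs (t • x₀ + s • x₁) (t • H₀ + s • H₁) Z ≤ t * Gam Θs x₀ H₀ Z + s * Gam Θs x₁ H₁ Z := by
  have e : Θs⁻¹ - (t • H₀ + s • H₁) = t • (Θs⁻¹ - H₀) + s • (Θs⁻¹ - H₁) := by
    obtain rfl : s = 1 - t := by linarith
    module
  have hP := (h₀.convex h₁ ht hs hts).posDef_inv_sub hΘs hγ
  rw [e] at hP
  have key := trace_inv_quadratic_convex hZ (h₀.posDef_inv_sub hΘs hγ)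
    (h₁.posDef_inv_sub hΘs hγ) ht hs hP (rowBlock x₀ H₀) (rowBlock x₁ H₁)
  rw [Gam_eq, Gam_eq, Gam_eq, e, borderBlock_add, rowBlock_add]
  simp only [borderBlock_smul, rowBlock_smul]
  have elin : (Z * (t • borderBlock x₀ H₀ + s • borderBlock x₁ H₁)).trace =
      t * (Z * borderBlock x₀ H₀).trace + s * (Z * borderBlock x₁ H₁).trace := by
    simp [mul_add]
  rw [elin]
  linarith

lemma Phi_convex (hΘs : Θs.PosDef) (hδ : 0 ≤ δ) (hγ₀ : 0 ≤ γ) (hγ : γ < 1)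
    {H₀ H₁ : Matrix (Fin d) (Fin d) ℝ} (h₀ : InDomain Θs γ H₀) (h₁ : InDomain Θs γ H₁)
    {t s : ℝ} (ht : 0 ≤ t) (hs : 0 ≤ s) (hts : t + s = 1) (x₀ x₁ : Fin d → ℝ)
    (Θ : Matrix (Fin d) (Fin d) ℝ)
    {Z : Matrix (Fin d ⊕ Unit) (Fin d ⊕ Unit) ℝ} (hZ : Z.PosSemidef) :
    Phi Θs δ (t • x₀ + s • x₁) (t • H₀ + s • H₁) Θ Z ≤
      t * Phi Θs δ x₀ H₀ Θ Z + s * Phi Θs δ x₁ H₁ Θ Z := by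
  have a := Upsilon_convex hΘs hδ hγ₀ hγ h₀ h₁ ht hs hts Θ
  have b := Gam_convex hΘs hγ h₀ h₁ ht hs hts x₀ x₁ hZ
  simp only [Phi]
  linarith

/-- From `-log det(1 - L) ≥ Tr L = Tr(Θ_*H)`, the `Θ_*` terms cancel; the remaining nonlinear terms
are nonnegative. -/
lemma linear_le_Phi (hΘs : Θs.PosDef) (hδ : 0 ≤ δ) (hγ₀ : 0 ≤ γ) (hγ : γ < 1)
    {H : Matrix (Fin d) (Fin d) ℝ} (hH : InDomain Θs γ H) (h : Fin d → ℝ)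
    (Θ : Matrix (Fin d) (Fin d) ℝ)
    {Z : Matrix (Fin d ⊕ Unit) (Fin d ⊕ Unit) ℝ} (hZ : Z.PosSemidef) :
    (1 / 2) * (Θ * H).trace + (1 / 2) * (Z * borderBlock h H).trace ≤ Phi Θs δ h H Θ Z := by
  have a := trace_inv_quadratic_nonneg hZ (hH.posDef_inv_sub hΘs hγ) (rowBlock h H)
  have b := log_det_le_trace_sub_card (hH.posDef_one_sub hΘs hγ₀ hγ)
  have n := (hH.specNorm_le hΘs hγ₀).trans_lt hγ
  have c : 0 ≤ δ * (2 + δ) / (2 * (1 - specNorm (CFC.sqrt Θs * H * CFC.sqrt Θs)))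
      * frobSq (CFC.sqrt Θs * H * CFC.sqrt Θs) :=
    mul_nonneg (div_nonneg (by positivity) (by linarith)) (frobSq_nonneg _)
  rw [trace_sub, trace_one, trace_mul_cycle, sqrt_mul_sqrt hΘs.posSemidef] at b
  rw [Phi, Upsilon, Gam_eq, sub_mul, trace_sub]
  linarith

end Convexity

/-! ### The infimum over scales and the maximum over `V × 𝒵`. -/

namespace Setup
variable {m k d : ℕ} {S : Setup m k d}

lemma mem_scales_iff {H : Matrix (Fin d) (Fin d) ℝ} {α : ℝ} :
    α ∈ S.scales H ↔ 0 < α ∧ InDomain S.Θs S.γ (α⁻¹ • H) := by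
  refine and_congr_right fun hα => ⟨fun h => ⟨?_, ?_⟩, fun h => ⟨?_, ?_⟩⟩
  · have := h.1.smul (inv_nonneg.2 hα.le)
    rwa [smul_add, smul_smul, show α⁻¹ * (S.γ * α) = S.γ by field_simp] at this
  · have := h.2.smul (inv_nonneg.2 hα.le)
    rwa [smul_sub, smul_smul, show α⁻¹ * (S.γ * α) = S.γ by field_simp] at this
  · have := h.lower.smul hα.le
    rwa [smul_add, smul_smul, smul_smul, mul_inv_cancel₀ hα.ne', one_smul, mul_comm α] at this
  · have := h.upper.smul hα.le
    rwa [smul_sub, smul_smul, smul_smul, mul_inv_cancel₀ hα.ne', one_smul, mul_comm α] at this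

lemma scales_nonempty (hS : S.Valid) {H : Matrix (Fin d) (Fin d) ℝ} (hH : H.IsSymm) :
    (S.scales H).Nonempty := by
  obtain ⟨hγ₀, -⟩ := hS.γ_mem
  set L := CFC.sqrt S.Θs * H * CFC.sqrt S.Θs with hL
  set r := specNorm L + 1 with hr
  have hr0 : 0 < r := by have := specNorm_nonneg L; linarith
  have hLH : L.IsHermitian := by
    rw [IsHermitian, conjTranspose_eq_transpose_of_trivial, hL, transpose_mul, transpose_mul, hH.eq,
      transpose_sqrt, mul_assoc]
  have hu := isUnit_det_sqrt hS.Θs_posDef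
  have hconj : ∀ X : Matrix (Fin d) (Fin d) ℝ, X.PosSemidef →
      ((CFC.sqrt S.Θs)⁻¹ * X * (CFC.sqrt S.Θs)⁻¹).PosSemidef := fun X hX => by
    have := hX.mul_mul_conjTranspose_same (CFC.sqrt S.Θs)⁻¹
    rwa [conjTranspose_eq_transpose_of_trivial, transpose_sqrt_inv] at this
  have hback : (CFC.sqrt S.Θs)⁻¹ * L * (CFC.sqrt S.Θs)⁻¹ = H := by
    rw [hL]
    calc _ = ((CFC.sqrt S.Θs)⁻¹ * CFC.sqrt S.Θs) * H *
          (CFC.sqrt S.Θs * (CFC.sqrt S.Θs)⁻¹) := by simp only [mul_assoc]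
      _ = H := by rw [mul_nonsing_inv _ hu, nonsing_inv_mul _ hu]; simp
  have hpos : ∀ X : Matrix (Fin d) (Fin d) ℝ, X.IsHermitian → specNorm X = specNorm L →
      (r • (1 : Matrix (Fin d) (Fin d) ℝ) - X).PosSemidef := fun X hX hn => by
    have h1 : (1 - r⁻¹ • X).PosDef := by
      refine posDef_one_sub (hX.smul (IsSelfAdjoint.all _)) ?_
      rw [specNorm_smul (inv_nonneg.2 hr0.le), hn, inv_mul_lt_iff₀ hr0]
      linarith
    have h2 := h1.posSemidef.smul hr0.le
    rwa [smul_sub, smul_smul, mul_inv_cancel₀ hr0.ne', one_smul] at h2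
  have hγr : S.γ * (r / S.γ) = r := by field_simp
  -- With this `α`, `γα = ‖L‖ + 1`; the added `1` keeps `α` positive even for `H = 0` and makes `‖L‖
  -- < γα` strict.
  refine ⟨r / S.γ, div_pos hr0 hγ₀, ?_, ?_⟩
  · have h := hconj _ (hpos (-L) hLH.neg (specNorm_neg L))
    rw [hγr, inv_eq_sqrt_inv_mul hS.Θs_posDef]
    simpa [mul_add, add_mul, hback, add_comm] using h
  · have h := hconj _ (hpos L hLH rfl)
    rw [hγr, inv_eq_sqrt_inv_mul hS.Θs_posDef]
    simpa [mul_sub, sub_mul, hback] using h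

lemma posSemidef_B_conj (hS : S.Valid) {Z : Matrix (Fin m ⊕ Unit) (Fin m ⊕ Unit) ℝ}
    (hZ : Z ∈ S.𝒵) : (S.B * Z * S.B.transpose).PosSemidef := by
  have := (hS.Z_psd Z hZ).mul_mul_conjTranspose_same S.B
  rwa [conjTranspose_eq_transpose_of_trivial] at this

lemma log_two_div_nonneg (hS : S.Valid) : 0 ≤ Real.log (2 / S.ε) := by
  obtain ⟨h0, h1⟩ := hS.ε_mem
  exact Real.log_nonneg (by rw [le_div_iff₀ h0]; linarith)

lemma linear_le_objPlus (hS : S.Valid) (h : Fin d → ℝ) {H : Matrix (Fin d) (Fin d) ℝ}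
    (v : Fin k → ℝ) {Z : Matrix (Fin m ⊕ Unit) (Fin m ⊕ Unit) ℝ} (hZ : Z ∈ S.𝒵) {α : ℝ}
    (hα : α ∈ S.scales H) :
    (1 / 2) * (S.M v * H).trace + (1 / 2) * (S.B * Z * S.B.transpose * borderBlock h H).trace
      - S.G v Z ≤ S.objPlus h H v Z α := by
  obtain ⟨hα0, hD⟩ := mem_scales_iff.1 hα
  have key := mul_le_mul_of_nonneg_left
    (linear_le_Phi hS.Θs_posDef hS.δ_mem.1 hS.γ_mem.1.le hS.γ_mem.2 hD (α⁻¹ • h) (S.M v)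
      (posSemidef_B_conj hS hZ)) hα0.le
  have hlog : 0 ≤ α / S.K * Real.log (2 / S.ε) :=
    mul_nonneg (by positivity) (log_two_div_nonneg hS)
  rw [borderBlock_smul, mul_smul_comm, mul_smul_comm, trace_smul, trace_smul] at key
  have e : α * ((1 / 2) * (α⁻¹ • (S.M v * H).trace) +
      (1 / 2) * (α⁻¹ • (S.B * Z * S.B.transpose * borderBlock h H).trace)) =
      (1 / 2) * (S.M v * H).trace +
        (1 / 2) * (S.B * Z * S.B.transpose * borderBlock h H).trace := by
    simp only [smul_eq_mul]
    field_simp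
  rw [e] at key
  rw [objPlus]
  linarith

lemma bddBelow_objPlus (hS : S.Valid) (h : Fin d → ℝ) (H : Matrix (Fin d) (Fin d) ℝ)
    (v : Fin k → ℝ) {Z : Matrix (Fin m ⊕ Unit) (Fin m ⊕ Unit) ℝ} (hZ : Z ∈ S.𝒵) :
    BddBelow (S.objPlus h H v Z '' S.scales H) :=
  ⟨_, Set.forall_mem_image.2 fun _ hα => linear_le_objPlus hS h v hZ hα⟩

lemma innerPlus_le (hS : S.Valid) (h : Fin d → ℝ) {H : Matrix (Fin d) (Fin d) ℝ}
    (v : Fin k → ℝ) {Z : Matrix (Fin m ⊕ Unit) (Fin m ⊕ Unit) ℝ} (hZ : Z ∈ S.𝒵) {α : ℝ}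
    (hα : α ∈ S.scales H) : S.innerPlus h H (v, Z) ≤ S.objPlus h H v Z α :=
  csInf_le (bddBelow_objPlus hS h H v hZ) (Set.mem_image_of_mem _ hα)

lemma exists_objPlus_lt (hS : S.Valid) (h : Fin d → ℝ) {H : Matrix (Fin d) (Fin d) ℝ}
    (hH : H.IsSymm) (x : (Fin k → ℝ) × Matrix (Fin m ⊕ Unit) (Fin m ⊕ Unit) ℝ) {c : ℝ}
    (hc : S.innerPlus h H x < c) : ∃ α ∈ S.scales H, S.objPlus h H x.1 x.2 α < c := by
  obtain ⟨_, ⟨α, hα, rfl⟩, hlt⟩ := exists_lt_of_csInf_lt ((scales_nonempty hS hH).image _) hc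
  exact ⟨α, hα, hlt⟩

/-- Convexity of a perspective: the scaled point at `aα₀ + bα₁` is the combination of the scaled
endpoints with weights `aα₀/α` and `bα₁/α`. -/
lemma objPlus_convex (hS : S.Valid) (h₀ h₁ : Fin d → ℝ) {H₀ H₁ : Matrix (Fin d) (Fin d) ℝ}
    (v : Fin k → ℝ) {Z : Matrix (Fin m ⊕ Unit) (Fin m ⊕ Unit) ℝ} (hZ : Z ∈ S.𝒵) {α₀ α₁ : ℝ}
    (hα₀ : α₀ ∈ S.scales H₀) (hα₁ : α₁ ∈ S.scales H₁) {a b : ℝ} (ha : 0 ≤ a) (hb : 0 ≤ b)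
    (hab : a + b = 1) :
    a * α₀ + b * α₁ ∈ S.scales (a • H₀ + b • H₁) ∧
    S.objPlus (a • h₀ + b • h₁) (a • H₀ + b • H₁) v Z (a * α₀ + b * α₁) ≤
      a * S.objPlus h₀ H₀ v Z α₀ + b * S.objPlus h₁ H₁ v Z α₁ := by
  obtain ⟨p₀, D₀⟩ := mem_scales_iff.1 hα₀
  obtain ⟨p₁, D₁⟩ := mem_scales_iff.1 hα₁
  set α := a * α₀ + b * α₁ with hα
  have p : 0 < α := by
    rcases ha.eq_or_lt with rfl | ha
    · obtain rfl : b = 1 := by linarith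
      simpa [hα] using p₁
    · have := mul_pos ha p₀
      have := mul_nonneg hb p₁.le
      linarith
  have ht : 0 ≤ a * α₀ / α := by positivity
  have hs : 0 ≤ b * α₁ / α := by positivity
  have hts : a * α₀ / α + b * α₁ / α = 1 := by rw [← add_div, ← hα, div_self p.ne']
  have eq : ∀ {E : Type} [AddCommGroup E] [Module ℝ E] (x y : E),
      α⁻¹ • (a • x + b • y) = (a * α₀ / α) • (α₀⁻¹ • x) + (b * α₁ / α) • (α₁⁻¹ • y) := by
    intro E _ _ x y
    rw [smul_add, smul_smul, smul_smul, smul_smul, smul_smul]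
    congr 2 <;> field_simp
  constructor
  · rw [mem_scales_iff, eq]
    exact ⟨p, D₀.convex D₁ ht hs hts⟩
  · have key := mul_le_mul_of_nonneg_left
      (Phi_convex hS.Θs_posDef hS.δ_mem.1 hS.γ_mem.1.le hS.γ_mem.2 D₀ D₁ ht hs hts
        (α₀⁻¹ • h₀) (α₁⁻¹ • h₁) (S.M v) (posSemidef_B_conj hS hZ)) p.le
    have e : ∀ x y : ℝ, α * (a * α₀ / α * x + b * α₁ / α * y) = a * (α₀ * x) + b * (α₁ * y) :=
      fun x y => by field_simp
    rw [e] at key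
    have eG : a * S.G v Z + b * S.G v Z = S.G v Z := by rw [← add_mul, hab, one_mul]
    have eK : α / S.K * Real.log (2 / S.ε) = a * (α₀ / S.K * Real.log (2 / S.ε)) +
        b * (α₁ / S.K * Real.log (2 / S.ε)) := by
      rw [hα]; ring
    simp only [objPlus, eq]
    rw [eK]
    linarith

lemma innerPlus_convex (hS : S.Valid) (h₀ h₁ : Fin d → ℝ) {H₀ H₁ : Matrix (Fin d) (Fin d) ℝ}
    (hH₀ : H₀.IsSymm) (hH₁ : H₁.IsSymm)
    (v : Fin k → ℝ) {Z : Matrix (Fin m ⊕ Unit) (Fin m ⊕ Unit) ℝ} (hZ : Z ∈ S.𝒵)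
    {a b : ℝ} (ha : 0 ≤ a) (hb : 0 ≤ b) (hab : a + b = 1) :
    S.innerPlus (a • h₀ + b • h₁) (a • H₀ + b • H₁) (v, Z) ≤
      a * S.innerPlus h₀ H₀ (v, Z) + b * S.innerPlus h₁ H₁ (v, Z) := by
  -- The infima over `α` need not be attained, so `η`-optimal scales are combined.
  refine le_of_forall_pos_le_add fun η hη => ?_
  obtain ⟨α₀, hα₀, l₀⟩ := exists_objPlus_lt hS h₀ hH₀ (v, Z) (lt_add_of_pos_right _ hη)
  obtain ⟨α₁, hα₁, l₁⟩ := exists_objPlus_lt hS h₁ hH₁ (v, Z) (lt_add_of_pos_right _ hη)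
  obtain ⟨hα, hle⟩ := objPlus_convex hS h₀ h₁ v hZ hα₀ hα₁ ha hb hab
  refine (innerPlus_le hS _ v hZ hα).trans (hle.trans ?_)
  have m₀ := mul_le_mul_of_nonneg_left l₀.le ha
  have m₁ := mul_le_mul_of_nonneg_left l₁.le hb
  have e : a * η + b * η = η := by rw [← add_mul, hab, one_mul]
  linarith

lemma continuous_objPlus (S : Setup m k d) (h : Fin d → ℝ) (H : Matrix (Fin d) (Fin d) ℝ) (α : ℝ) :
    Continuous fun x : (Fin k → ℝ) × Matrix (Fin m ⊕ Unit) (Fin m ⊕ Unit) ℝ =>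
      S.objPlus h H x.1 x.2 α := by
  have hM : Continuous S.M := by
    rw [AffineMap.decomp S.M]
    exact S.M.linear.continuous_of_finiteDimensional.add continuous_const
  unfold objPlus Phi Upsilon Gam G
  fun_prop

lemma upperSemicontinuousOn_innerPlus (hS : S.Valid) (h : Fin d → ℝ)
    {H : Matrix (Fin d) (Fin d) ℝ} (hH : H.IsSymm) :
    UpperSemicontinuousOn (S.innerPlus h H) (S.V ×ˢ S.𝒵) := by
  intro x _ c hc
  -- The admissible scales do not depend on `(v, Z)`, so an `α` good at `x` remains admissible at
  -- nearby points.
  obtain ⟨α, hα, hlt⟩ := exists_objPlus_lt hS h hH x hc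
  have hev := (continuous_objPlus S h H α).continuousAt.eventually_lt_const hlt
  filter_upwards [nhdsWithin_le_nhds hev, self_mem_nhdsWithin] with y hy hyS
  exact (innerPlus_le hS h y.1 hyS.2 hα).trans_lt hy

lemma domain_nonempty (hS : S.Valid) : (S.V ×ˢ S.𝒵).Nonempty := by
  obtain ⟨u, hu⟩ := hS.U_nonempty
  exact hS.V_nonempty.prod ⟨_, hS.Z_lift u hu⟩

lemma isGreatest_PsiPlus (hS : S.Valid) (h : Fin d → ℝ)
    {H : Matrix (Fin d) (Fin d) ℝ} (hH : H.IsSymm) :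
    IsGreatest (S.innerPlus h H '' (S.V ×ˢ S.𝒵)) (S.PsiPlus h H) := by
  obtain ⟨x, hx, hmax⟩ := (upperSemicontinuousOn_innerPlus hS h hH).exists_isMaxOn
    (domain_nonempty hS) (hS.V_compact.prod hS.Z_compact)
  have hg : IsGreatest (S.innerPlus h H '' (S.V ×ˢ S.𝒵)) (S.innerPlus h H x) :=
    ⟨Set.mem_image_of_mem _ hx, Set.forall_mem_image.2 fun _ hy => hmax hy⟩
  rwa [PsiPlus, hg.csSup_eq]

lemma innerPlus_le_PsiPlus (hS : S.Valid) (h : Fin d → ℝ)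
    {H : Matrix (Fin d) (Fin d) ℝ} (hH : H.IsSymm) {v : Fin k → ℝ} (hv : v ∈ S.V)
    {Z : Matrix (Fin m ⊕ Unit) (Fin m ⊕ Unit) ℝ} (hZ : Z ∈ S.𝒵) :
    S.innerPlus h H (v, Z) ≤ S.PsiPlus h H :=
  (isGreatest_PsiPlus hS h hH).2 (Set.mem_image_of_mem _ ⟨hv, hZ⟩)

lemma convex_symm_pairs (d : ℕ) :
    Convex ℝ {p : (Fin d → ℝ) × Matrix (Fin d) (Fin d) ℝ | p.2.IsSymm} := by
  intro p hp q hq a b _ _ _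
  simp only [Set.mem_ofPred_eq, Prod.snd_add, Prod.smul_snd] at hp hq ⊢
  exact (hp.smul a).add (hq.smul b)

lemma convexOn_PsiPlus (hS : S.Valid) :
    ConvexOn ℝ {p : (Fin d → ℝ) × Matrix (Fin d) (Fin d) ℝ | p.2.IsSymm}
      (fun p => S.PsiPlus p.1 p.2) := by
  refine ⟨convex_symm_pairs d, fun p hp q hq a b ha hb hab => ?_⟩
  simp only [Set.mem_ofPred_eq] at hp hq
  refine csSup_le ((domain_nonempty hS).image _) (Set.forall_mem_image.2 ?_)
  rintro ⟨v, Z⟩ ⟨hv, hZ⟩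
  refine (innerPlus_convex hS p.1 q.1 hp hq v hZ ha hb hab).trans ?_
  exact add_le_add
    (mul_le_mul_of_nonneg_left (innerPlus_le_PsiPlus hS p.1 hp hv hZ) ha)
    (mul_le_mul_of_nonneg_left (innerPlus_le_PsiPlus hS q.1 hq hv hZ) hb)

end Setup
end QuadLift
end

/-! ### Tail bounds for the estimate. -/

noncomputable section

namespace QuadLift
open Matrix MeasureTheory ProbabilityTheory

/-- Continuity from below along `η = 1/(n+1)`; it removes the slack left by unattained infima. -/
lemma measure_lt_le_of_forall_pos {Ω : Type*} [MeasurableSpace Ω] {P : Measure Ω} {g : Ω → ℝ}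
    {ρ : ℝ} {c : ENNReal} (h : ∀ η > 0, P {x | ρ + η ≤ g x} ≤ c) : P {x | ρ < g x} ≤ c := by
  have e : {x | ρ < g x} = ⋃ n : ℕ, {x | ρ + 1 / ((n : ℝ) + 1) ≤ g x} := by
    ext x
    simp only [Set.mem_ofPred_eq, Set.mem_iUnion]
    constructor
    · intro hx
      obtain ⟨n, hn⟩ := exists_nat_one_div_lt (sub_pos.2 hx)
      exact ⟨n, by linarith⟩
    · rintro ⟨n, hn⟩
      have : 0 < 1 / ((n : ℝ) + 1) := by positivity
      linarith
  have hmono : Monotone fun n : ℕ => {x | ρ + 1 / ((n : ℝ) + 1) ≤ g x} := by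
    intro a b hab x hx
    have := Nat.one_div_le_one_div (α := ℝ) hab
    simp only [Set.mem_ofPred_eq] at hx ⊢
    linarith
  rw [e, hmono.measure_iUnion]
  exact iSup_le fun n => h _ (by positivity)

namespace Setup
variable {m k d : ℕ} {S : Setup m k d}

lemma G_liftMat (S : Setup m k d) (u : Fin m → ℝ) (v : Fin k → ℝ) :
    S.G v (liftMat u) = S.F u v := by
  rw [G, F, liftMat, mul_vecMulVec, trace_vecMulVec, dotProduct_comm]

lemma B_mulVec_lift1 (S : Setup m k d) (u : Fin m → ℝ) :
    S.B *ᵥ lift1 u = lift1 (S.A *ᵥ lift1 u) := by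
  ext (i | i)
  · simp [B, lift1, mulVec]
  · simp [B, lift1, mulVec, dotProduct]

lemma B_conj_liftMat (S : Setup m k d) (u : Fin m → ℝ) :
    S.B * liftMat u * S.B.transpose =
      vecMulVec (lift1 (S.A *ᵥ lift1 u)) (lift1 (S.A *ᵥ lift1 u)) := by
  rw [liftMat, mul_vecMulVec, vecMulVec_mul, vecMul_transpose, B_mulVec_lift1]

instance (u : Fin m → ℝ) (v : Fin k → ℝ) : IsProbabilityMeasure (S.obsLaw u v) := by
  unfold obsLaw; infer_instance

instance (u : Fin m → ℝ) (v : Fin k → ℝ) : IsProbabilityMeasure (S.sampleLaw u v) := by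
  unfold sampleLaw; infer_instance

lemma measurable_estimate (S : Setup m k d) (h : Fin d → ℝ) (H : Matrix (Fin d) (Fin d) ℝ)
    (ϰ : ℝ) : Measurable (S.estimate h H ϰ) := by
  refine Continuous.measurable ?_
  unfold estimate mulVec dotProduct
  fun_prop

/-- The quadratic function `ζ ↦ hᵀ ζ + ½ ζᵀ H ζ`. -/
def quadForm (h : Fin d → ℝ) (H : Matrix (Fin d) (Fin d) ℝ) (ζ : EuclideanSpace ℝ (Fin d)) : ℝ :=
  h ⬝ᵥ ζ.ofLp + (1 / 2) * (ζ.ofLp ⬝ᵥ H *ᵥ ζ.ofLp)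

lemma quadForm_smul (a : ℝ) (h : Fin d → ℝ) (H : Matrix (Fin d) (Fin d) ℝ)
    (ζ : EuclideanSpace ℝ (Fin d)) : quadForm (a • h) (a • H) ζ = a * quadForm h H ζ := by
  simp only [quadForm, smul_dotProduct, smul_mulVec, dotProduct_smul, smul_eq_mul]
  ring

lemma exp_moment_sample_le (hS : S.Valid) (h : Fin d → ℝ) {H : Matrix (Fin d) (Fin d) ℝ}
    (hH : InDomain S.Θs S.γ H) (u : Fin m → ℝ) {v : Fin k → ℝ} (hv : v ∈ S.V) :
    Integrable (fun ζ => Real.exp (∑ i, quadForm h H (ζ i))) (S.sampleLaw u v) ∧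
    ∫ ζ, Real.exp (∑ i, quadForm h H (ζ i)) ∂(S.sampleLaw u v) ≤
      Real.exp (S.K * Phi S.Θs S.δ h H (S.M v) (S.B * liftMat u * S.B.transpose)) := by
  obtain ⟨hint, hle⟩ := exp_moment_le_Phi hS.Θs_posDef (hS.M_psd v hv) (hS.M_le v hv) hS.δ_mem.1
    (hS.M_close v hv) hS.γ_mem.1.le hS.γ_mem.2 hH h (S.A *ᵥ lift1 u)
  rw [← B_conj_liftMat] at hle
  simp only [Real.exp_sum]
  unfold sampleLaw
  refine ⟨Integrable.fintype_prod fun _ => hint, ?_⟩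
  rw [integral_fintype_prod_eq_prod (f := fun _ ζ => Real.exp (quadForm h H ζ)),
    Finset.prod_const, Finset.card_univ, Fintype.card_fin, Real.exp_nat_mul]
  exact pow_le_pow_left₀ (integral_nonneg fun _ => (Real.exp_pos _).le) hle _

lemma upper_tail_le (hS : S.Valid) (h : Fin d → ℝ) {H : Matrix (Fin d) (Fin d) ℝ}
    (hH : H.IsSymm) {ρ ϰ : ℝ} (hΨ : S.PsiPlus h H ≤ ρ - ϰ) {u : Fin m → ℝ} (hu : u ∈ S.U)
    {v : Fin k → ℝ} (hv : v ∈ S.V) :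
    S.sampleLaw u v {ζ | ρ < S.estimate h H ϰ ζ - S.F u v} ≤ ENNReal.ofReal (S.ε / 2) := by
  refine measure_lt_le_of_forall_pos fun η hη => ?_
  have hlt : S.innerPlus h H (v, liftMat u) < ρ - ϰ + η :=
    ((innerPlus_le_PsiPlus hS h hH hv (hS.Z_lift u hu)).trans hΨ).trans_lt
      (lt_add_of_pos_right _ hη)
  obtain ⟨α, hα, hobj⟩ := exists_objPlus_lt hS h hH _ hlt
  obtain ⟨hα0, hD⟩ := mem_scales_iff.1 hα
  have hK : (0 : ℝ) < S.K := Nat.cast_pos.2 hS.K_pos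
  obtain ⟨hint, hle⟩ := exp_moment_sample_le hS (α⁻¹ • h) hD u hv
  set φ := Phi S.Θs S.δ (α⁻¹ • h) (α⁻¹ • H) (S.M v) (S.B * liftMat u * S.B.transpose) with hφ
  -- The factor `1/α` is already inside `X`, so Markov's inequality is applied with exponential
  -- parameter `1`.
  set X : (Fin S.K → EuclideanSpace ℝ (Fin d)) → ℝ :=
    fun ζ => ∑ i, quadForm (α⁻¹ • h) (α⁻¹ • H) (ζ i) with hX
  set c := S.K / α * (ρ + η - ϰ + S.F u v) with hc
  have hest : ∀ ζ, S.estimate h H ϰ ζ = α / S.K * X ζ + ϰ := fun ζ => by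
    simp only [hX, quadForm_smul, ← Finset.mul_sum]
    rw [estimate, ← mul_assoc, show α / S.K * α⁻¹ = 1 / S.K by field_simp]
    rfl
  have hset : {ζ | ρ + η ≤ S.estimate h H ϰ ζ - S.F u v} = {ζ | c ≤ X ζ} := by
    ext ζ
    simp only [Set.mem_ofPred_eq, hest, hc]
    rw [div_mul_eq_mul_div, div_mul_eq_mul_div, div_le_iff₀ hα0]
    constructor
    · intro h1
      have h2 : ρ + η - ϰ + S.F u v ≤ α * X ζ / S.K := by linarith
      rw [le_div_iff₀ hK] at h2
      linarith
    · intro h1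
      have h2 : ρ + η - ϰ + S.F u v ≤ α * X ζ / S.K := by
        rw [le_div_iff₀ hK]
        linarith
      linarith
  have hmarkov := measure_ge_le_exp_mul_mgf (μ := S.sampleLaw u v) (X := X) c zero_le_one
    (by simpa only [one_mul] using hint)
  have hmgf : mgf X (S.sampleLaw u v) 1 ≤ Real.exp (S.K * φ) := by
    simpa only [mgf, one_mul] using hle
  -- This is the strict bound on `objPlus` at `α`, multiplied by `K/α`.
  have hexp : -1 * c + S.K * φ ≤ -Real.log (2 / S.ε) := by
    simp only [objPlus, G_liftMat] at hobj
    rw [← hφ] at hobj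
    have h1 := mul_le_mul_of_nonneg_left hobj.le (div_pos hK hα0).le
    have h2 : S.K / α * (α * φ - S.F u v + α / S.K * Real.log (2 / S.ε)) =
        S.K * φ - S.K / α * S.F u v + Real.log (2 / S.ε) := by
      field_simp
    rw [h2] at h1
    rw [hc]
    linarith
  rw [hset, ← ofReal_measureReal]
  refine ENNReal.ofReal_le_ofReal (hmarkov.trans ?_)
  calc Real.exp (-1 * c) * mgf X (S.sampleLaw u v) 1
      ≤ Real.exp (-1 * c) * Real.exp (S.K * φ) :=
        mul_le_mul_of_nonneg_left hmgf (Real.exp_pos _).le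
    _ = Real.exp (-1 * c + S.K * φ) := (Real.exp_add _ _).symm
    _ ≤ Real.exp (-Real.log (2 / S.ε)) := Real.exp_le_exp.2 hexp
    _ = S.ε / 2 := by
        rw [Real.exp_neg, Real.exp_log (div_pos two_pos hS.ε_mem.1), inv_div]

/-- The same problem with the functional of interest replaced by its negative. -/
def negate (S : Setup m k d) : Setup m k d := { S with Q := -S.Q, q := -S.q }

lemma Valid.negate (hS : S.Valid) : S.negate.Valid :=
  { hS with Q_symm := hS.Q_symm.neg }

lemma F_negate (u : Fin m → ℝ) (v : Fin k → ℝ) : S.negate.F u v = -S.F u v := by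
  simp [F, Setup.negate, neg_mulVec]
  ring

lemma G_negate (v : Fin k → ℝ) (Z : Matrix (Fin m ⊕ Unit) (Fin m ⊕ Unit) ℝ) :
    S.negate.G v Z = -S.G v Z := by
  simp [G, Setup.negate]
  ring

lemma objPlus_negate (h : Fin d → ℝ) (H : Matrix (Fin d) (Fin d) ℝ) :
    S.negate.objPlus (-h) (-H) = S.objMinus h H := by
  funext v Z α
  rw [objPlus, objMinus, G_negate, smul_neg, smul_neg, sub_neg_eq_add]
  rfl

lemma scales_negate (H : Matrix (Fin d) (Fin d) ℝ) : S.negate.scales (-H) = S.scales H := by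
  ext α
  refine and_congr_right fun _ => ?_
  rw [and_comm, sub_neg_eq_add, add_comm _ H, neg_add_eq_sub]
  rfl

lemma innerPlus_negate (h : Fin d → ℝ) (H : Matrix (Fin d) (Fin d) ℝ) :
    S.negate.innerPlus (-h) (-H) = S.innerMinus h H := by
  funext x
  rw [innerPlus, innerMinus, objPlus_negate, scales_negate]

/-- Changing the signs of `F`, `h` and `H` exchanges the two signs in the construction, so every
fact about `PsiMinus` is inherited from `PsiPlus`. -/
lemma PsiPlus_negate (h : Fin d → ℝ) (H : Matrix (Fin d) (Fin d) ℝ) :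
    S.negate.PsiPlus (-h) (-H) = S.PsiMinus h H := by
  rw [PsiPlus, PsiMinus, innerPlus_negate]
  rfl

lemma bddBelow_objMinus (hS : S.Valid) (h : Fin d → ℝ) (H : Matrix (Fin d) (Fin d) ℝ)
    (v : Fin k → ℝ) {Z : Matrix (Fin m ⊕ Unit) (Fin m ⊕ Unit) ℝ} (hZ : Z ∈ S.𝒵) :
    BddBelow (S.objMinus h H v Z '' S.scales H) := by
  have := bddBelow_objPlus hS.negate (-h) (-H) v hZ
  rwa [objPlus_negate, scales_negate] at this

lemma isGreatest_PsiMinus (hS : S.Valid) (h : Fin d → ℝ)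
    {H : Matrix (Fin d) (Fin d) ℝ} (hH : H.IsSymm) :
    IsGreatest (S.innerMinus h H '' (S.V ×ˢ S.𝒵)) (S.PsiMinus h H) := by
  have := isGreatest_PsiPlus hS.negate (-h) hH.neg
  rwa [innerPlus_negate, PsiPlus_negate] at this

lemma convexOn_PsiMinus (hS : S.Valid) :
    ConvexOn ℝ {p : (Fin d → ℝ) × Matrix (Fin d) (Fin d) ℝ | p.2.IsSymm}
      (fun p => S.PsiMinus p.1 p.2) := by
  refine ⟨convex_symm_pairs d, fun p hp q hq a b ha hb hab => ?_⟩
  have h := (convexOn_PsiPlus hS.negate).2 (x := -p) (y := -q) (Matrix.IsSymm.neg hp)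
    (Matrix.IsSymm.neg hq) ha hb hab
  rw [smul_neg, smul_neg, ← neg_add] at h
  simpa only [Prod.fst_neg, Prod.snd_neg, PsiPlus_negate] using h

lemma estimate_negate (h : Fin d → ℝ) (H : Matrix (Fin d) (Fin d) ℝ) (ϰ : ℝ)
    (ζ : Fin S.K → EuclideanSpace ℝ (Fin d)) :
    S.negate.estimate (-h) (-H) (-ϰ) ζ = -S.estimate h H ϰ ζ := by
  have e : ∀ i, -h ⬝ᵥ (ζ i).ofLp + (1 / 2) * ((ζ i).ofLp ⬝ᵥ (-H) *ᵥ (ζ i).ofLp) =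
      -(h ⬝ᵥ (ζ i).ofLp + (1 / 2) * ((ζ i).ofLp ⬝ᵥ H *ᵥ (ζ i).ofLp)) := fun i => by
    rw [neg_mulVec, neg_dotProduct, dotProduct_neg]
    ring
  change (1 / (S.K : ℝ)) * ∑ i : Fin S.K, (-h ⬝ᵥ (ζ i).ofLp +
    (1 / 2) * ((ζ i).ofLp ⬝ᵥ (-H) *ᵥ (ζ i).ofLp)) + -ϰ = _
  simp only [e, Finset.sum_neg_distrib, estimate]
  ring

lemma lower_tail_le (hS : S.Valid) (h : Fin d → ℝ) {H : Matrix (Fin d) (Fin d) ℝ}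
    (hH : H.IsSymm) {ρ ϰ : ℝ} (hΨ : S.PsiMinus h H ≤ ρ + ϰ) {u : Fin m → ℝ} (hu : u ∈ S.U)
    {v : Fin k → ℝ} (hv : v ∈ S.V) :
    S.sampleLaw u v {ζ | ρ < S.F u v - S.estimate h H ϰ ζ} ≤ ENNReal.ofReal (S.ε / 2) := by
  rw [← PsiPlus_negate, ← sub_neg_eq_add] at hΨ
  have key := upper_tail_le hS.negate (-h) hH.neg hΨ hu hv
  have e : ∀ ζ : Fin S.K → EuclideanSpace ℝ (Fin d),
      S.negate.estimate (-h) (-H) (-ϰ) ζ - S.negate.F u v = S.F u v - S.estimate h H ϰ ζ :=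
    fun ζ => by rw [estimate_negate, F_negate]; ring
  have e2 : {ζ : Fin S.K → EuclideanSpace ℝ (Fin d) | ρ < S.F u v - S.estimate h H ϰ ζ} =
      {ζ | ρ < S.negate.estimate (-h) (-H) (-ϰ) ζ - S.negate.F u v} := by
    ext ζ
    exact (iff_of_eq (congrArg (ρ < ·) (e ζ))).symm
  rw [e2]
  exact key

/-! ### From the two tails to the risk. -/

lemma mem_riskBounds (hS : S.Valid) (h : Fin d → ℝ) {H : Matrix (Fin d) (Fin d) ℝ}
    (hH : H.IsSymm) {ρ ϰ : ℝ} (hΨ : S.PsiPlus h H ≤ ρ - ϰ) (hΨ' : S.PsiMinus h H ≤ ρ + ϰ) :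
    ρ ∈ S.riskBounds (S.estimate h H ϰ) := by
  intro u hu v hv
  have hsub : {ζ | ρ < |S.estimate h H ϰ ζ - S.F u v|} ⊆
      {ζ | ρ < S.estimate h H ϰ ζ - S.F u v} ∪ {ζ | ρ < S.F u v - S.estimate h H ϰ ζ} := by
    intro ζ hζ
    simp only [Set.mem_union, Set.mem_ofPred_eq, lt_abs, neg_sub] at hζ ⊢
    exact hζ
  calc _ ≤ _ := measure_mono hsub
    _ ≤ _ := measure_union_le _ _
    _ ≤ ENNReal.ofReal (S.ε / 2) + ENNReal.ofReal (S.ε / 2) :=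
        add_le_add (upper_tail_le hS h hH hΨ hu hv) (lower_tail_le hS h hH hΨ' hu hv)
    _ = ENNReal.ofReal S.ε := by
        have := hS.ε_mem.1
        rw [← ENNReal.ofReal_add (by linarith) (by linarith), add_halves]

lemma nonneg_of_mem_riskBounds (hS : S.Valid)
    {g : (Fin S.K → EuclideanSpace ℝ (Fin d)) → ℝ} {r : ℝ} (hr : r ∈ S.riskBounds g) : 0 ≤ r := by
  by_contra! hneg
  obtain ⟨u, hu⟩ := hS.U_nonempty
  obtain ⟨v, hv⟩ := hS.V_nonempty
  have h := hr u hu v hv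
  have e : {ζ | r < |g ζ - S.F u v|} = Set.univ :=
    Set.eq_univ_of_forall fun ζ => hneg.trans_le (abs_nonneg _)
  rw [e, measure_univ] at h
  have h2 : ENNReal.ofReal S.ε < 1 := ENNReal.ofReal_lt_one.2 hS.ε_mem.2
  exact absurd h (not_le.2 h2)

/-- The risk is a minimum: the bounds are nonnegative because `ε < 1`, and their infimum is again a
bound by continuity from below. -/
lemma exists_isRisk_le (hS : S.Valid) {g : (Fin S.K → EuclideanSpace ℝ (Fin d)) → ℝ}
    (hg : Measurable g) {ρ : ℝ} (hρ : ρ ∈ S.riskBounds g) : ∃ r, S.IsRisk g r ∧ r ≤ ρ := by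
  have hbdd : BddBelow (S.riskBounds g) := ⟨0, fun _ hr => nonneg_of_mem_riskBounds hS hr⟩
  refine ⟨sInf (S.riskBounds g), ⟨hg, fun u hu v hv => ?_, fun _ hr => csInf_le hbdd hr⟩,
    csInf_le hbdd hρ⟩
  refine measure_lt_le_of_forall_pos fun η hη => ?_
  obtain ⟨r, hr, hlt⟩ := exists_lt_of_csInf_lt ⟨ρ, hρ⟩ (lt_add_of_pos_right (sInf _) hη)
  exact (measure_mono fun ζ hζ => hlt.trans_le hζ).trans (hr u hu v hv)

end Setup
end QuadLift
end

theorem proposition5p1 {m k d : ℕ} (S : QuadLift.Setup m k d) (hS : S.Valid) :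
    -- the infima in the definition of `Ψ̂₊`, `Ψ̂₋` are over nonempty sets of reals bounded below
    (∀ (h : Fin d → ℝ) (H : Matrix (Fin d) (Fin d) ℝ), H.IsSymm →
      (S.scales H).Nonempty ∧
      ∀ v ∈ S.V, ∀ Z ∈ S.𝒵,
        BddBelow (S.objPlus h H v Z '' S.scales H) ∧
        BddBelow (S.objMinus h H v Z '' S.scales H)) ∧
    -- and the maxima are attained, so that `Ψ̂₊`, `Ψ̂₋` are well-defined real-valued functions
    (∀ (h : Fin d → ℝ) (H : Matrix (Fin d) (Fin d) ℝ), H.IsSymm →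
      IsGreatest (S.innerPlus h H '' (S.V ×ˢ S.𝒵)) (S.PsiPlus h H) ∧
      IsGreatest (S.innerMinus h H '' (S.V ×ˢ S.𝒵)) (S.PsiMinus h H)) ∧
    -- `Ψ̂₊`, `Ψ̂₋` are convex on `ℝ^d × S^d`
    ConvexOn ℝ {p : (Fin d → ℝ) × Matrix (Fin d) (Fin d) ℝ | p.2.IsSymm}
      (fun p => S.PsiPlus p.1 p.2) ∧
    ConvexOn ℝ {p : (Fin d → ℝ) × Matrix (Fin d) (Fin d) ℝ | p.2.IsSymm}
      (fun p => S.PsiMinus p.1 p.2) ∧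
    -- every feasible solution yields an estimate with `ε`-risk at most `ρ`
    (∀ (h : Fin d → ℝ) (H : Matrix (Fin d) (Fin d) ℝ) (ρ ϰ : ℝ), H.IsSymm →
      S.PsiPlus h H ≤ ρ - ϰ → S.PsiMinus h H ≤ ρ + ϰ →
      (∀ u ∈ S.U, ∀ v ∈ S.V,
        MeasureTheory.Measure.pi (fun _ : Fin S.K =>
            ProbabilityTheory.multivariateGaussian
              (WithLp.toLp 2 (S.A.mulVec (QuadLift.lift1 u))) (S.M v))
          {ζ | ρ < |S.F u v - S.estimate h H ϰ ζ|} ≤ ENNReal.ofReal S.ε) ∧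
      ∃ r, S.IsRisk (S.estimate h H ϰ) r ∧ r ≤ ρ) ∧
    -- the particular choice of `ρ`, `ϰ`
    (∀ (h : Fin d → ℝ) (H : Matrix (Fin d) (Fin d) ℝ), H.IsSymm →
      ∃ r, S.IsRisk
          (S.estimate h H ((1 / 2) * (S.PsiMinus h H - S.PsiPlus h H))) r ∧
        r ≤ (1 / 2) * (S.PsiPlus h H + S.PsiMinus h H)) := by
  have feasible : ∀ (h : Fin d → ℝ) (H : Matrix (Fin d) (Fin d) ℝ) (ρ ϰ : ℝ), H.IsSymm →
      S.PsiPlus h H ≤ ρ - ϰ → S.PsiMinus h H ≤ ρ + ϰ →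
      ∃ r, S.IsRisk (S.estimate h H ϰ) r ∧ r ≤ ρ := fun h H ρ ϰ hH h₁ h₂ =>
    QuadLift.Setup.exists_isRisk_le hS (S.measurable_estimate h H ϰ)
      (QuadLift.Setup.mem_riskBounds hS h hH h₁ h₂)
  refine ⟨fun h H hH => ⟨QuadLift.Setup.scales_nonempty hS hH, fun v _ Z hZ =>
      ⟨QuadLift.Setup.bddBelow_objPlus hS h H v hZ, QuadLift.Setup.bddBelow_objMinus hS h H v hZ⟩⟩,
    fun h H hH => ⟨QuadLift.Setup.isGreatest_PsiPlus hS h hH,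
      QuadLift.Setup.isGreatest_PsiMinus hS h hH⟩,
    QuadLift.Setup.convexOn_PsiPlus hS, QuadLift.Setup.convexOn_PsiMinus hS,
    fun h H ρ ϰ hH h₁ h₂ => ⟨fun u hu v hv => ?_, feasible h H ρ ϰ hH h₁ h₂⟩,
    -- Taking `ρ` as the half-sum of the two values, with `ϰ` their half-difference, turns both
    -- feasibility constraints into equalities.
    fun h H hH => feasible h H _ _ hH (by linarith) (by linarith)⟩
  have key := QuadLift.Setup.mem_riskBounds hS h hH h₁ h₂ u hu v hv
  simp only [abs_sub_comm (S.estimate h H ϰ _)] at key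
  exact key
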